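/- **Proposition (Potential kernel estimate).** Let $(X,\mathcal C,m,T)$ be a probability measure preserving system, let $\varphi:X\to\mathbb R$ be measurable, and set $S_n=\sum_{k=1}^{n}\varphi\circ T^{k-1}$, $m(g)=\int_X g\,dm$. Let $\hat T:L^1(m)\to L^1(m)$ be the transfer operator, determined by $\int f\cdot (g\circ T)\,dm=\int \hat Tf\cdot g\,dm$ for $f\in L^1(m)$, $g\in L^\infty(m)$, and for $t\in\mathbb R$ let $P(t)f=\hat T(e^{it\varphi}f)$. Denote spectral radius by $\rho$, and assume: - (A1) $\mathcal B\subseteq L^\infty(m)$ is a complex Banach space with norm $\|\cdot\|$ such that $\|\cdot\|_\infty\le C_0\|\cdot\|$ for some $C_0>0$, $\mathbb 1\in\mathcal B$, and $f\in\mathcal B$ implies $\bar f\in\mathcal B$ and $|f|\in\mathcal B$. - (A2) $\hat T:\mathcal B\to\mathcal B$ is quasi-compact with one dominating simple eigenvalue, equal to $1$ (that is, $\mathcal B=F\oplus H$ with $F,H$ closed and $\hat T$-invariant, $\dim F=1$, $\hat T=1$ on $F$, $\rho(\hat T)=1$ and $\rho(\hat T|_H)<1$), and $\hat Tf=m(f)\mathbb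 1+Nf$ for $f\in\mathcal B$, where $N$ is a bounded operator on $\mathcal B$ with $\rho(N)<1$. - (A3) $\varphi\in L^2(m)$ and $m(\varphi)=0$. - (A4) Each $P(t)$ acts as a bounded operator on $\mathcal B$, and $t\mapsto P(t)$ is continuous from $\mathbb R$ to $\mathrm{Hom}(\mathcal B,\mathcal B)$ with the operator norm. - (A5) On some open neighbourhood of $0$, $t\mapsto P(t)\in \mathrm{Hom}(\mathcal B,\mathcal B)$ is twice continuously differentiable, with $P'(0)f=\hat T(i\varphi f)$ and $P''(0)f=\hat T(-\varphi^2 f)$ for all $f\in\mathcal B$. - (A6) As an operator on $\mathcal B$, $P(t)$ satisfies $\rho(P(t))<1$ for every $t\ne0$. Let $f:\mathbb R\to\mathbb R$ be a smooth, integrable, symmetric ($f(-x)=f(x)$) function whose Fourier transform has compact support. Then $f(S_n+y)$ is $m$-integrable for all $n\geq 0$ and $y\in\mathbb R$, and there is a constant $C>0$ such that for all $y\in\mathbb R$ the following series converges and $$\sum_{n=1}^{\infty}\bigl|m\bigl(f(S_n)-f(S_n+y)\bigr)\bigr|\le C|y|.$$ -/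

import Mathlib

open MeasureTheory Set Filter Topology
open scoped ENNReal FourierTransform ComplexConjugate

noncomputable section

section Transfer

variable {X : Type*} [MeasurableSpace X]

/-- The transfer (Frobenius–Perron) operator `T̂` of a measure preserving map `T` of `(X, m)`:
for integrable `f`, the Radon–Nikodym derivative with respect to `m` of the image under `T` of the
complex measure `f dm`. As an `L¹` class it is the unique integrable function with
`∫ f · (g ∘ T) dm = ∫ T̂ f · g dm` for all `g ∈ L^∞(m)`; see `integrable_transferOp` and
`integral_mul_comp_eq_integral_transferOp_mul`. -/
def transferOp (m : Measure X) (T : X → X) (f : X → ℂ) : X → ℂ :=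
  ComplexMeasure.rnDeriv (VectorMeasure.map (m.withDensityᵥ f) T) m

/-- The characteristic function operator `P(t) f = T̂ (e^{itφ} f)`. -/
def charOp (m : Measure X) (T : X → X) (φ : X → ℝ) (t : ℝ) (f : X → ℂ) : X → ℂ :=
  transferOp m T fun x => Complex.exp (Complex.I * t * φ x) * f x

theorem integrable_transferOp (m : Measure X) (T : X → X) (f : X → ℂ) :
    Integrable (transferOp m T f) m :=
  ComplexMeasure.integrable_rnDeriv _ _

theorem setIntegral_transferOp {m : Measure X} [IsFiniteMeasure m] {T : X → X}
    (hT : MeasurePreserving T m m) {f : X → ℂ} (hf : Integrable f m) {A : Set X}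
    (hA : MeasurableSet A) :
    ∫ x in A, transferOp m T f x ∂m = ∫ x in T ⁻¹' A, f x ∂m := by
  set c : ComplexMeasure X := VectorMeasure.map (m.withDensityᵥ f) T with hc
  have hcA : ∀ B, MeasurableSet B → c B = ∫ x in T ⁻¹' B, f x ∂m := fun B hB => by
    rw [hc, VectorMeasure.map_apply _ hT.measurable hB,
      withDensityᵥ_apply hf (hT.measurable hB)]
  have habs : c ≪ᵥ m.toENNRealVectorMeasure := by
    refine VectorMeasure.AbsolutelyContinuous.mk fun B hB hB0 => ?_
    rw [Measure.toENNRealVectorMeasure_apply_measurable hB] at hB0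
    rw [hcA B hB]
    exact setIntegral_measure_zero _ (by rw [hT.measure_preimage hB.nullMeasurableSet, hB0])
  obtain ⟨h1, h2⟩ := (ComplexMeasure.absolutelyContinuous_ennreal_iff c _).1 habs
  have e1 := SignedMeasure.withDensityᵥ_rnDeriv_eq _ _ h1
  have e2 := SignedMeasure.withDensityᵥ_rnDeriv_eq _ _ h2
  have i1 := SignedMeasure.integrable_rnDeriv (ComplexMeasure.re c) m
  have i2 := SignedMeasure.integrable_rnDeriv (ComplexMeasure.im c) m
  have hi : Integrable (transferOp m T f) m := integrable_transferOp m T f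
  rw [← hcA A hA]
  apply Complex.ext
  · have h3 : (∫ x in A, transferOp m T f x ∂m).re = ∫ x in A, (transferOp m T f x).re ∂m :=
      (integral_re (𝕜 := ℂ) hi.integrableOn).symm
    rw [h3]
    have h4 := congrArg (fun v : SignedMeasure X => v A) e1
    simp only [withDensityᵥ_apply i1 hA] at h4
    exact h4
  · have h3 : (∫ x in A, transferOp m T f x ∂m).im = ∫ x in A, (transferOp m T f x).im ∂m :=
      (integral_im (𝕜 := ℂ) hi.integrableOn).symm
    rw [h3]
    have h4 := congrArg (fun v : SignedMeasure X => v A) e2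
    simp only [withDensityᵥ_apply i2 hA] at h4
    exact h4

/-- The duality that characterizes the transfer operator. -/
theorem integral_mul_comp_eq_integral_transferOp_mul {m : Measure X} [IsFiniteMeasure m]
    {T : X → X} (hT : MeasurePreserving T m m) {f : X → ℂ} (hf : Integrable f m) {g : X → ℂ}
    (hg : MemLp g ∞ m) :
    ∫ x, f x * g (T x) ∂m = ∫ x, transferOp m T f x * g x ∂m := by
  have hi : Integrable (transferOp m T f) m := integrable_transferOp m T f
  -- simple functions
  have key : ∀ s : SimpleFunc X ℂ,
      ∫ x, f x * s (T x) ∂m = ∫ x, transferOp m T f x * s x ∂m := by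
    intro s
    have bd : ∀ u : SimpleFunc X ℂ, ∃ C, ∀ x, ‖u x‖ ≤ C := fun u => u.exists_forall_norm_le
    have int1 : ∀ u : SimpleFunc X ℂ, Integrable (fun x => f x * u (T x)) m := fun u => by
      obtain ⟨C, hC⟩ := bd u
      exact hf.mul_bdd (c := C) ((u.measurable.comp hT.measurable).aestronglyMeasurable)
        (Eventually.of_forall fun x => hC _)
    have int2 : ∀ u : SimpleFunc X ℂ, Integrable (fun x => transferOp m T f x * u x) m :=
      fun u => by
      obtain ⟨C, hC⟩ := bd u
      exact hi.mul_bdd (c := C) u.measurable.aestronglyMeasurable (Eventually.of_forall fun x => hC _)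
    induction s using SimpleFunc.induction with
    | const c hs =>
      rename_i A
      have a1 : ∀ x, f x * (SimpleFunc.piecewise A hs (SimpleFunc.const X c)
          (SimpleFunc.const X 0)) (T x) = (T ⁻¹' A).indicator (fun x => f x * c) x := by
        intro x
        by_cases hx : T x ∈ A <;> simp [indicator, hx]
      have a2 : ∀ x, transferOp m T f x * (SimpleFunc.piecewise A hs (SimpleFunc.const X c)
          (SimpleFunc.const X 0)) x = A.indicator (fun x => transferOp m T f x * c) x := by
        intro x
        by_cases hx : x ∈ A <;> simp [indicator, hx]
      simp_rw [a1, a2]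
      rw [integral_indicator (hT.measurable hs), integral_indicator hs, integral_mul_const,
        integral_mul_const, setIntegral_transferOp hT hf hs]
    | add _ hu hv =>
      rename_i u v _
      simp only [SimpleFunc.coe_add, Pi.add_apply, mul_add]
      rw [integral_add (int1 u) (int1 v), integral_add (int2 u) (int2 v), hu, hv]
  -- pass to a strongly measurable version and approximate
  set g' : X → ℂ := hg.1.mk g with hg'
  have hgg' : g =ᵐ[m] g' := hg.1.ae_eq_mk
  have sm : StronglyMeasurable g' := hg.1.stronglyMeasurable_mk
  set C : ℝ := (eLpNormEssSup g m).toReal with hC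
  have hbd : ∀ᵐ x ∂m, ‖g' x‖ ≤ C := by
    have hfin : eLpNormEssSup g m ≠ ∞ := by
      have := hg.2.ne
      rwa [eLpNorm_exponent_top] at this
    filter_upwards [hgg', enorm_ae_le_eLpNormEssSup g m] with x hx h
    rw [← hx, ← toReal_enorm]
    exact ENNReal.toReal_mono hfin h
  have hC0 : 0 ≤ C := ENNReal.toReal_nonneg
  have lim : ∀ᵐ x ∂m, Tendsto (fun n => sm.approxBounded C n x) atTop (𝓝 (g' x)) :=
    sm.tendsto_approxBounded_ae hbd
  have bdn : ∀ n x, ‖sm.approxBounded C n x‖ ≤ C := fun n x => sm.norm_approxBounded_le hC0 n x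
  have L1 : Tendsto (fun n => ∫ x, f x * sm.approxBounded C n (T x) ∂m) atTop
      (𝓝 (∫ x, f x * g' (T x) ∂m)) := by
    refine tendsto_integral_of_dominated_convergence (fun x => ‖f x‖ * C) (fun n => ?_)
      (hf.norm.mul_const C) (fun n => Eventually.of_forall fun x => ?_) ?_
    · exact hf.1.mul
        (((sm.approxBounded C n).measurable.comp hT.measurable).aestronglyMeasurable)
    · rw [norm_mul]
      exact mul_le_mul_of_nonneg_left (bdn n _) (norm_nonneg _)
    · filter_upwards [hT.quasiMeasurePreserving.ae lim] with x hx
      exact hx.const_mul _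
  have L2 : Tendsto (fun n => ∫ x, transferOp m T f x * sm.approxBounded C n x ∂m) atTop
      (𝓝 (∫ x, transferOp m T f x * g' x ∂m)) := by
    refine tendsto_integral_of_dominated_convergence (fun x => ‖transferOp m T f x‖ * C)
      (fun n => ?_) (hi.norm.mul_const C) (fun n => Eventually.of_forall fun x => ?_) ?_
    · exact hi.1.mul (sm.approxBounded C n).measurable.aestronglyMeasurable
    · rw [norm_mul]
      exact mul_le_mul_of_nonneg_left (bdn n _) (norm_nonneg _)
    · filter_upwards [lim] with x hx
      exact hx.const_mul _
  have e1 : ∫ x, f x * g (T x) ∂m = ∫ x, f x * g' (T x) ∂m := by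
    refine integral_congr_ae ?_
    filter_upwards [hT.quasiMeasurePreserving.ae hgg'] with x hx
    rw [hx]
  have e2 : ∫ x, transferOp m T f x * g x ∂m = ∫ x, transferOp m T f x * g' x ∂m := by
    refine integral_congr_ae ?_
    filter_upwards [hgg'] with x hx
    rw [hx]
  rw [e1, e2]
  refine tendsto_nhds_unique L1 ?_
  simp_rw [key]
  exact L2

end Transfer

/-- `ι` realizes the complex Banach space `B` as a subspace of `L^∞(m)` with
`‖·‖_∞ ≤ C ‖·‖` for some `C > 0`, that contains the constant function `1` and is closed under
complex conjugation and absolute value. -/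
structure IsBanachFunctionSpace {X : Type*} [MeasurableSpace X] (m : Measure X)
    {B : Type*} [NormedAddCommGroup B] [NormedSpace ℂ B] [CompleteSpace B]
    (ι : B →ₗ[ℂ] Lp ℂ ∞ m) : Prop where
  injective : Function.Injective ι
  norm_le : ∃ C : ℝ, 0 < C ∧ ∀ b, ‖ι b‖ ≤ C * ‖b‖
  one_mem : ∃ b, ∀ᵐ x ∂m, ι b x = 1
  conj_mem : ∀ b, ∃ b', ∀ᵐ x ∂m, ι b' x = conj (ι b x)
  abs_mem : ∀ b, ∃ b', ∀ᵐ x ∂m, ι b' x = (‖ι b x‖ : ℂ)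

/-- The bounded operator `L` is quasi-compact with `s` dominating simple eigenvalues
`μ₁, …, μ_s`: the space is a direct sum of `L`-invariant subspaces `F ⊕ H`, where `F` has a basis
of eigenvectors `v₁, …, v_s` of `L` with eigenvalues `μ₁, …, μ_s`, all of modulus equal to the
spectral radius of `L`, and where `H` is closed and the restriction of `L` to `H` has spectral
radius strictly less than that of `L`. -/
def IsQuasiCompactWith {B : Type*} [NormedAddCommGroup B] [NormedSpace ℂ B] (L : B →L[ℂ] B)
    {s : ℕ} (μ : Fin s → ℂ) : Prop :=
  ∃ (v : Fin s → B) (H : Submodule ℂ B) (hH : ∀ x ∈ H, L x ∈ H),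
    LinearIndependent ℂ v ∧ (∀ i, L (v i) = μ i • v i) ∧
    IsClosed (H : Set B) ∧ IsCompl (Submodule.span ℂ (range v)) H ∧
    (∀ i, (‖μ i‖ₑ : ℝ≥0∞) = spectralRadius ℂ L) ∧
    spectralRadius ℂ (L.restrict hH) < spectralRadius ℂ L

end

/-! Fourier inversion writes `f` as a superposition of cosines `cos (t x)` with a continuous,
compactly supported density `h`. Hence `m(f(S_n) - f(S_n + y))` is the integral of `h(t)` times `(1
- cos ty) Re χ_n(t) + sin(ty) Im χ_n(t)`, where `χ_n(t) = m(e^{itS_n}) = ℓ(P(t)^n 1)` and `ℓ` is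
integration against `m`. It suffices to bound the sums over `n` of the absolute integrands by one
function of `t` whose integral is `O(|y|)`.

Away from `t = 0`, powers of `P(t)` decay exponentially, uniformly on compact sets, and both
trigonometric factors are at most `|ty|`. Near `0`, perturbation theory gives `χ_n = c μ^n + O(t²
θ^n)` with `μ = 1 - s t² + o(t²)` and `s > 0` (`exists_spectral_expansion`,
`variance_pos_of_tendsto_zero`). Thus `∑ |χ_n| = O(t⁻²)`, and the cosine part is dominated by a
multiple of `y² / (1 + t²y²)`, whose integral is `π|y|`.

The sine part is the delicate one: it needs `|t| ∑ |Im χ_n|` to be integrable near `0`, while the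
sum costs `|Im μ| t⁻⁴`. The second order operator correction to `μ` is real
(`second_order_coefficient_im_eq_zero`), so `Im μ = m(sin tφ) + O(t³)`. With only two moments `m(sin
tφ)` need not be `O(t³)` pointwise, but `|t|⁻³ |m(sin tφ)|` is integrable in `t`: subtract `tφ`,
which has mean zero, and integrate in `t` first (`integrable_cube_kernel`, `abs_integral_sin_le`).
-/

noncomputable section

/-! ### Powers and spectral projections in Banach algebras -/

/-- Powers of elements near one of spectral radius less than one decay uniformly. -/
theorem eventually_norm_pow_le_of_spectralRadius_lt_one {A : Type*} [NormedRing A]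
    [NormedAlgebra ℂ A] [CompleteSpace A]
    {a : A} (h : spectralRadius ℂ a < 1) :
    ∃ C θ : ℝ, 0 ≤ C ∧ 0 < θ ∧ θ < 1 ∧ ∀ᶠ b in 𝓝 a, ∀ n : ℕ, ‖b ^ n‖ ≤ C * θ ^ n := by
  obtain ⟨θ, h1, h2⟩ := ENNReal.lt_iff_exists_nnreal_btwn.1 h
  have h2' : θ < 1 := by exact_mod_cast h2
  have h0 : 0 < θ := by
    have : (0 : ℝ≥0∞) < θ := lt_of_le_of_lt (zero_le) h1
    exact_mod_cast this
  -- Gelfand's formula yields a single `k` with `‖a ^ k‖ < θ ^ k`. This is an open condition on `a`,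
  -- which makes the decay locally uniform.
  have ev := (spectrum.pow_nnnorm_pow_one_div_tendsto_nhds_spectralRadius a).eventually_lt_const h1
  obtain ⟨k, hk, hk0⟩ := (ev.and (eventually_gt_atTop 0)).exists
  have hak : ‖a ^ k‖ < (θ : ℝ) ^ k := by
    have h3 : ((‖a ^ k‖₊ : ℝ≥0∞) ^ (1 / (k : ℝ))) ^ (k : ℝ) < (θ : ℝ≥0∞) ^ (k : ℝ) :=
      ENNReal.rpow_lt_rpow hk (by positivity)
    rw [← ENNReal.rpow_mul, one_div_mul_cancel (by positivity), ENNReal.rpow_one,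
      ENNReal.rpow_natCast] at h3
    have h4 : ‖a ^ k‖₊ < θ ^ k := by exact_mod_cast h3
    exact_mod_cast h4
  set K : ℝ := ‖a‖ + 1 with hK
  have hK1 : 1 ≤ K := by linarith [norm_nonneg a]
  have hθ0 : (0 : ℝ) < θ := h0
  have hθ1 : (θ : ℝ) < 1 := h2'
  -- Division of `n` by `k` leaves fewer than `k` factors, at most `K ^ k` in norm; `(θ ^ k)⁻¹`
  -- compensates the missing powers of `θ`. The factors `‖1‖ + 1` cover zeroth powers, since `‖1‖ =
  -- 1` is not assumed.
  refine ⟨(‖(1 : A)‖ + 1) * (‖(1 : A)‖ + 1) * (K ^ k * ((θ : ℝ) ^ k)⁻¹), θ, by positivity,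
    hθ0, hθ1, ?_⟩
  have c1 : ∀ᶠ b : A in 𝓝 a, ‖b ^ k‖ < (θ : ℝ) ^ k :=
    ((continuous_pow k).norm.tendsto a).eventually_lt_const hak
  have c2 : ∀ᶠ b : A in 𝓝 a, ‖b‖ < K :=
    (continuous_norm.tendsto a).eventually_lt_const (by linarith)
  filter_upwards [c1, c2] with b hb1 hb2 n
  have pw : ∀ (x : A) (j : ℕ), ‖x ^ j‖ ≤ (‖(1 : A)‖ + 1) * ‖x‖ ^ j := by
    intro x j
    rcases Nat.eq_zero_or_pos j with rfl | hj
    · simp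
    · exact (norm_pow_le' x hj).trans
        (le_mul_of_one_le_left (by positivity) (by linarith [norm_nonneg (1 : A)]))
  have hr : n % k < k := Nat.mod_lt _ hk0
  have e : b ^ n = (b ^ k) ^ (n / k) * b ^ (n % k) := by
    rw [← pow_mul, ← pow_add, Nat.div_add_mod]
  have e2 : (θ : ℝ) ^ n = ((θ : ℝ) ^ k) ^ (n / k) * (θ : ℝ) ^ (n % k) := by
    rw [← pow_mul, ← pow_add, Nat.div_add_mod]
  have b1 : ‖(b ^ k) ^ (n / k)‖ ≤ (‖(1 : A)‖ + 1) * ((θ : ℝ) ^ k) ^ (n / k) :=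
    (pw _ _).trans (by gcongr)
  have b2 : ‖b ^ (n % k)‖ ≤ (‖(1 : A)‖ + 1) * K ^ k := by
    refine (pw _ _).trans ?_
    gcongr
    calc ‖b‖ ^ (n % k) ≤ K ^ (n % k) := by gcongr
      _ ≤ K ^ k := pow_le_pow_right₀ hK1 hr.le
  have b3 : (θ : ℝ) ^ k ≤ (θ : ℝ) ^ (n % k) := pow_le_pow_of_le_one hθ0.le hθ1.le hr.le
  have b4 : 1 ≤ ((θ : ℝ) ^ k)⁻¹ * (θ : ℝ) ^ (n % k) := by
    rw [inv_mul_eq_div, one_le_div (by positivity)]; exact b3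
  calc ‖b ^ n‖ ≤ ‖(b ^ k) ^ (n / k)‖ * ‖b ^ (n % k)‖ := by rw [e]; exact norm_mul_le _ _
    _ ≤ ((‖(1 : A)‖ + 1) * ((θ : ℝ) ^ k) ^ (n / k)) * ((‖(1 : A)‖ + 1) * K ^ k) := by gcongr
    _ ≤ ((‖(1 : A)‖ + 1) * ((θ : ℝ) ^ k) ^ (n / k)) * ((‖(1 : A)‖ + 1) * K ^ k) *
        (((θ : ℝ) ^ k)⁻¹ * (θ : ℝ) ^ (n % k)) := le_mul_of_one_le_right (by positivity) b4
    _ = _ := by rw [e2]; ring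

/-- `P` splits along the commuting projection `Q`. Both factors `1 - Q` are kept: in a matrix
element each becomes a difference of `Q` and the unperturbed projection, so the remainder is
quadratically small. -/
theorem pow_eq_smul_add_mul {A : Type*} [Ring A] [Algebra ℂ A] {P Q : A} {μ : ℂ}
    (hPQ : P * Q = μ • Q) (hQP : Q * P = μ • Q) (hQ : Q * Q = Q) (n : ℕ) :
    P ^ n = μ ^ n • Q + (1 - Q) * (P - μ • Q) ^ n * (1 - Q) := by
  have h1 : P * (1 - Q) = P - μ • Q := by rw [mul_sub, mul_one, hPQ]
  have h2 : (1 - Q) * (P - μ • Q) = P - μ • Q := by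
    rw [sub_mul, one_mul, mul_sub, hQP, mul_smul_comm, hQ, sub_self, sub_zero]
  induction n with
  | zero => simp only [pow_zero, one_smul, mul_one, sub_mul, mul_sub, one_mul, hQ]; abel
  | succ n ih =>
    have h3 : P * ((1 - Q) * (P - μ • Q) ^ n * (1 - Q)) =
        (1 - Q) * (P - μ • Q) ^ (n + 1) * (1 - Q) := by
      rw [pow_succ', ← mul_assoc, ← mul_assoc, h1, ← mul_assoc, h2]
    rw [pow_succ', ih, mul_add, h3, mul_smul_comm, hPQ, smul_smul, ← pow_succ]

/-! ### The perturbed eigenvalue equation -/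

section Perturbation

variable {B : Type*} [NormedAddCommGroup B] [NormedSpace ℂ B]

/-- A rank one perturbation `ℓ(·) one + N` has the eigenvalue `μ` as soon as
`ℓ ((1 - μ⁻¹ N)⁻¹ one) = μ`, with an explicit spectral projection. -/
theorem rankOne_add_eigenprojection {ℓ : B →L[ℂ] ℂ} {one : B} {N R : B →L[ℂ] B} {μ : ℂ}
    (hμ : μ ≠ 0) (hR1 : (1 - μ⁻¹ • N) * R = 1) (hR2 : R * (1 - μ⁻¹ • N) = 1)
    (hμR : ℓ (R one) = μ) (hκ : ℓ (R (R one)) ≠ 0) {Q : B →L[ℂ] B}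
    (hQ : Q = (ℓ (R (R one)))⁻¹ • (R * ℓ.smulRight one * R)) :
    (ℓ.smulRight one + N) * Q = μ • Q ∧ Q * (ℓ.smulRight one + N) = μ • Q ∧ Q * Q = Q := by
  have a1 : ∀ b, N (R b) = μ • R b - μ • b := fun b => by
    have := congrArg (fun S : B →L[ℂ] B => μ • S b) hR1
    simp only [mul_apply_eq_comp, sub_apply,
      one_apply_eq_self, smul_apply, smul_sub, smul_smul,
      mul_inv_cancel₀ hμ, one_smul] at this
    rw [← this]; abel
  have a2 : ∀ b, R (N b) = μ • R b - μ • b := fun b => by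
    have := congrArg (fun S : B →L[ℂ] B => μ • S b) hR2
    simp only [mul_apply_eq_comp, sub_apply,
      one_apply_eq_self, smul_apply, smul_sub, smul_smul,
      mul_inv_cancel₀ hμ, one_smul, map_sub, map_smul] at this
    rw [← this]; abel
  refine ⟨?_, ?_, ?_⟩
  · ext b
    simp only [hQ, mul_apply_eq_comp, add_apply,
      smul_apply, ContinuousLinearMap.smulRight_apply,
      map_smul, a1, hμR]
    module
  · ext b
    simp only [hQ, mul_apply_eq_comp, add_apply,
      smul_apply, ContinuousLinearMap.smulRight_apply,
      map_smul, map_add, map_sub, a2, hμR]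
    module
  · ext b
    simp only [hQ, mul_apply_eq_comp,
      smul_apply, ContinuousLinearMap.smulRight_apply,
      map_smul]
    rw [inv_smul_smul₀ hκ]

/-- Two resolvent iterations, one from each side. Since `N₀` kills `one` and is killed by `ℓ`, the
first order term is only `ℓ (D one)`, and everything else is quadratic in `D`. -/
theorem resolvent_expansion {ℓ : B →L[ℂ] ℂ} {one : B} {N₀ D R : B →L[ℂ] B} {μ : ℂ}
    (hR1 : (1 - μ⁻¹ • (N₀ + D)) * R = 1) (hR2 : R * (1 - μ⁻¹ • (N₀ + D)) = 1)
    (hN1 : N₀ one = 0) (hNl : ∀ b, ℓ (N₀ b) = 0) :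
    ℓ (R one) = ℓ one + μ⁻¹ * ℓ (D one) + μ⁻¹ ^ 2 * ℓ (D (R (D one))) := by
  have a1 : R one = one + μ⁻¹ • (N₀ (R one) + D (R one)) := by
    have := congrArg (fun S : B →L[ℂ] B => S one) hR1
    simp only [mul_apply_eq_comp, sub_apply,
      one_apply_eq_self, smul_apply,
      add_apply] at this
    exact eq_add_of_sub_eq this
  have a2 : R one = one + μ⁻¹ • R (D one) := by
    have := congrArg (fun S : B →L[ℂ] B => S one) hR2
    simp only [mul_apply_eq_comp, sub_apply,
      one_apply_eq_self, smul_apply,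
      add_apply, hN1, zero_add, map_sub, map_smul] at this
    exact eq_add_of_sub_eq this
  have e1 : ℓ (R one) = ℓ one + μ⁻¹ * ℓ (D (R one)) := by
    conv_lhs => rw [a1]
    simp [hNl]
  have e2 : ℓ (D (R one)) = ℓ (D one) + μ⁻¹ * ℓ (D (R (D one))) := by
    conv_lhs => rw [a2]
    simp
  rw [e1, e2]; ring

variable [CompleteSpace B]

theorem contDiffAt_inverse_one_sub_inv_smul {N : ℝ → B →L[ℂ] B} (hN : ContDiffAt ℝ 1 N 0)
    (hu : IsUnit (1 - N 0)) :
    ContDiffAt ℝ 1 (fun p : ℝ × ℂ => Ring.inverse (1 - p.2⁻¹ • N p.1)) ((0 : ℝ), (1 : ℂ)) := by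
  have hin : ContDiffAt ℝ 1 (fun p : ℝ × ℂ => 1 - p.2⁻¹ • N p.1) ((0 : ℝ), (1 : ℂ)) := by
    have e1 : ContDiffAt ℝ 1 (fun p : ℝ × ℂ => p.2⁻¹) ((0 : ℝ), (1 : ℂ)) :=
      contDiffAt_snd.inv (by simp)
    have e2 : ContDiffAt ℝ 1 (fun p : ℝ × ℂ => N p.1) ((0 : ℝ), (1 : ℂ)) :=
      ContDiffAt.comp (f := Prod.fst) ((0 : ℝ), (1 : ℂ)) hN contDiffAt_fst
    exact contDiffAt_const.sub (e1.smul e2)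
  have h := contDiffAt_ringInverse ℝ (n := 1) hu.unit
  refine ContDiffAt.comp (g := Ring.inverse) ((0 : ℝ), (1 : ℂ)) ?_ hin
  simpa using h

/-- The equation `ℓ ((1 - μ⁻¹ N(t))⁻¹ one) = μ` has solutions `μ` near `1` for small `t`. -/
theorem exists_eigenvalue_near_one {ℓ : B →L[ℂ] ℂ} {one : B} {N : ℝ → B →L[ℂ] B}
    (hN : ContDiffAt ℝ 1 N 0) (h1 : ℓ one = 1) (hN1 : N 0 one = 0)
    (hu : IsUnit (1 - N 0)) {U : Set (ℝ × ℂ)} (hU : U ∈ 𝓝 ((0 : ℝ), (1 : ℂ))) :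
    ∀ᶠ t in 𝓝 (0 : ℝ), ∃ μ : ℂ, (t, μ) ∈ U ∧
      ℓ (Ring.inverse (1 - μ⁻¹ • N t) one) = μ := by
  set G : ℝ × ℂ → ℂ := fun p => p.2 - ℓ (Ring.inverse (1 - p.2⁻¹ • N p.1) one) with hG
  have hR := contDiffAt_inverse_one_sub_inv_smul hN hu
  have hGd : ContDiffAt ℝ 1 G ((0 : ℝ), (1 : ℂ)) := by
    refine contDiffAt_snd.sub ?_
    have e3 : ContDiff ℝ 1 fun S : B →L[ℂ] B => ℓ (S one) :=
      ((ℓ.comp (ContinuousLinearMap.apply ℂ B one)).restrictScalars ℝ).contDiff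
    exact e3.contDiffAt.comp _ hR
  -- At `t = 0` the resolvent fixes `one`, so `G (0, μ) = μ - 1` and the partial derivative in `μ`
  -- is the identity.
  have hev : ∀ᶠ μ : ℂ in 𝓝 1, G (0, μ) = μ - 1 := by
    have c : ContinuousAt (fun μ : ℂ => 1 - μ⁻¹ • N 0) 1 := by
      have : ContinuousAt (fun μ : ℂ => μ⁻¹) 1 := continuousAt_inv₀ one_ne_zero
      exact continuousAt_const.sub (this.smul continuousAt_const)
    have hu' : {x : B →L[ℂ] B | IsUnit x} ∈ 𝓝 ((fun μ : ℂ => 1 - μ⁻¹ • N 0) 1) := by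
      refine Units.isOpen.mem_nhds ?_
      simpa using hu
    filter_upwards [c.preimage_mem_nhds hu'] with μ hμ
    have e4 := Ring.inverse_mul_cancel _ hμ
    have e5 := congrArg (fun S : B →L[ℂ] B => S one) e4
    simp only [mul_apply_eq_comp, sub_apply,
      one_apply_eq_self, smul_apply, hN1, smul_zero,
      sub_zero] at e5
    simp only [hG, e5, h1]
  have hs := hGd.hasStrictFDerivAt (by simp)
  set G' := fderiv ℝ G ((0 : ℝ), (1 : ℂ)) with hG'
  have hG'2 : ∀ z : ℂ, G' (0, z) = z := by
    have d1 : HasFDerivAt (fun μ : ℂ => G (0, μ)) (G'.comp (ContinuousLinearMap.inr ℝ ℝ ℂ)) 1 :=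
      hs.hasFDerivAt.comp (1 : ℂ) (hasFDerivAt_prodMk_right (0 : ℝ) (1 : ℂ))
    have d2 : HasFDerivAt (fun μ : ℂ => G (0, μ)) (ContinuousLinearMap.id ℝ ℂ) 1 :=
      ((hasFDerivAt_id (1 : ℂ)).sub_const 1).congr_of_eventuallyEq hev
    intro z
    have := congrArg (fun S : ℂ →L[ℝ] ℂ => S z) (d1.unique d2)
    simpa using this
  -- A surjective strict derivative makes `(t, μ) ↦ (t, G (t, μ))` open at the base point, so its
  -- image of `U` contains `(t, 0)` for small `t`. Uniqueness of `μ` is not needed.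
  have hΦ : HasStrictFDerivAt (fun p : ℝ × ℂ => (p.1, G p))
      ((ContinuousLinearMap.fst ℝ ℝ ℂ).prod G') ((0 : ℝ), (1 : ℂ)) :=
    hasStrictFDerivAt_fst.prodMk hs
  have hsurj : ((ContinuousLinearMap.fst ℝ ℝ ℂ).prod G').range = ⊤ := by
    refine LinearMap.range_eq_top.2 fun q => ⟨(q.1, q.2 - G' (q.1, 0)), ?_⟩
    have e6 : G' (q.1, q.2 - G' (q.1, 0)) = q.2 := by
      have : (q.1, q.2 - G' (q.1, 0)) = (q.1, (0 : ℂ)) + (0, q.2 - G' (q.1, 0)) := by simp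
      rw [this, map_add, hG'2]; ring
    ext1
    · simp
    · simpa using e6
  have hmap := hΦ.map_nhds_eq_of_surj hsurj
  have hG0 : G ((0 : ℝ), (1 : ℂ)) = 0 := by
    have := hev.self_of_nhds
    simpa using this
  rw [hG0] at hmap
  have him : (fun p : ℝ × ℂ => (p.1, G p)) '' U ∈ 𝓝 ((0 : ℝ), (0 : ℂ)) := by
    rw [← hmap]; exact image_mem_map hU
  have hc : ContinuousAt (fun t : ℝ => (t, (0 : ℂ))) 0 := by fun_prop
  filter_upwards [hc.preimage_mem_nhds him] with t ht
  obtain ⟨p, hp, hpt⟩ := ht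
  obtain ⟨q1, q2⟩ := p
  simp only [Prod.mk.injEq] at hpt
  obtain ⟨rfl, h0⟩ := hpt
  exact ⟨q2, hp, (sub_eq_zero.1 h0).symm⟩

end Perturbation

/-! ### Asymptotics of the leading eigenvalue and of the matrix element -/

section Perturbation

variable {B : Type*} [NormedAddCommGroup B] [NormedSpace ℂ B] [CompleteSpace B]

theorem ContDiffAt.isBigO_sub_sub_smul_deriv {E : Type*} [NormedAddCommGroup E]
    [NormedSpace ℝ E] {P : ℝ → E} (hP : ContDiffAt ℝ 2 P 0) :
    (fun t => P t - P 0 - t • deriv P 0) =O[𝓝 0] fun t : ℝ => t ^ 2 := by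
  obtain ⟨u, hu, hPu⟩ := hP.contDiffOn (m := 2) le_rfl (by simp)
  obtain ⟨r, hr, hru⟩ := Metric.mem_nhds_iff.1 (by simpa using hu)
  have h0 : (0 : ℝ) ∈ Metric.ball (0 : ℝ) r := Metric.mem_ball_self hr
  have hb : Metric.ball (0 : ℝ) r ∈ 𝓝 (0 : ℝ) := Metric.ball_mem_nhds _ hr
  have h1 := taylor_isLittleO (convex_ball (0 : ℝ) r) h0 (n := 2) (hPu.mono hru)
  rw [nhdsWithin_eq_nhds.2 hb] at h1
  have h2 : (fun t : ℝ => ((2 : ℝ)⁻¹ * t ^ 2) • iteratedDerivWithin 2 P (Metric.ball 0 r) 0)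
      =O[𝓝 0] fun t : ℝ => t ^ 2 := by
    refine Asymptotics.IsBigO.of_bound (‖iteratedDerivWithin 2 P (Metric.ball 0 r) 0‖)
      (Eventually.of_forall fun t => ?_)
    rw [norm_smul, norm_mul]
    have : ‖(2 : ℝ)⁻¹‖ ≤ 1 := by norm_num
    nlinarith [norm_nonneg (iteratedDerivWithin 2 P (Metric.ball 0 r) 0), norm_nonneg (t ^ 2),
      mul_nonneg (norm_nonneg (iteratedDerivWithin 2 P (Metric.ball 0 r) 0))
        (norm_nonneg (t ^ 2))]
  have h3 : derivWithin P (Metric.ball 0 r) 0 = deriv P 0 :=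
    derivWithin_of_mem_nhds hb
  have h4 := h1.isBigO
  simp only [sub_zero] at h4
  refine (h4.add h2).congr_left fun t => ?_
  simp only [taylorWithinEval_succ, taylor_within_zero_eval, sub_zero]
  norm_num
  rw [h3]
  abel

/-- Spectral expansion at `t = 0` of the matrix element `ℓ (P(t)ⁿ one)`. -/
theorem exists_spectral_expansion {P : ℝ → B →L[ℂ] B} {ℓ : B →L[ℂ] ℂ} {one : B}
    (h1 : ℓ one = 1) (hP1 : P 0 one = one) (hPl : ∀ b, ℓ (P 0 b) = ℓ b)
    (hρ : spectralRadius ℂ (P 0 - ℓ.smulRight one) < 1) (hP : ContDiffAt ℝ 2 P 0)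
    (hreal : (ℓ (deriv P 0 (Ring.inverse (1 - (P 0 - ℓ.smulRight one))
      (deriv P 0 one)))).im = 0) {a : ℝ}
    (ha : (fun t : ℝ => ℓ (P t one) - (1 - a * t ^ 2)) =o[𝓝 0] fun t : ℝ => t ^ 2) :
    ∃ s C θ : ℝ, 0 ≤ C ∧ 0 < θ ∧ θ < 1 ∧ ∀ ε > 0, ∀ᶠ t : ℝ in 𝓝 0, ∃ μ c : ℂ,
      ‖μ - 1 + s * t ^ 2‖ ≤ ε * t ^ 2 ∧ |μ.im| ≤ |(ℓ (P t one)).im| + C * |t| ^ 3 ∧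
      ‖c - 1‖ ≤ C * t ^ 2 ∧ ∀ n : ℕ, ‖ℓ ((P t ^ n) one) - c * μ ^ n‖ ≤ C * t ^ 2 * θ ^ n := by
  set E₁ : B →L[ℂ] B := ℓ.smulRight one with hE
  set N : ℝ → B →L[ℂ] B := fun t => P t - E₁ with hN
  have hN1 : N 0 one = 0 := by simp [hN, hE, hP1, h1]
  have hNl : ∀ b, ℓ (N 0 b) = 0 := fun b => by simp [hN, hE, hPl, h1]
  have hNd : ContDiffAt ℝ 1 N 0 := (hP.of_le (by norm_num)).sub contDiffAt_const
  have hu : IsUnit (1 - N 0) := by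
    have := spectrum.mem_resolventSet_of_spectralRadius_lt (𝕜 := ℂ) (a := N 0) (k := 1)
      (by simpa using hρ)
    rw [spectrum.mem_resolventSet_iff] at this
    simpa using this
  set p₀ : ℝ × ℂ := ((0 : ℝ), (1 : ℂ)) with hp₀
  set R : ℝ × ℂ → B →L[ℂ] B := fun p => Ring.inverse (1 - p.2⁻¹ • N p.1) with hR
  set R₀ : B →L[ℂ] B := Ring.inverse (1 - N 0) with hR₀
  have hRp₀ : R p₀ = R₀ := by simp [hR, hp₀, hR₀]
  have hR₀1 : R₀ one = one := by
    have := congrArg (fun S : B →L[ℂ] B => S one) (Ring.inverse_mul_cancel _ hu)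
    simpa [hN1] using this
  have hR₀l : ∀ b, ℓ (R₀ b) = ℓ b := fun b => by
    have := congrArg (fun S : B →L[ℂ] B => ℓ (S b)) (Ring.mul_inverse_cancel _ hu)
    simpa [hNl] using this
  have hRd : DifferentiableAt ℝ R p₀ :=
    (contDiffAt_inverse_one_sub_inv_smul hNd hu).differentiableAt (by simp)
  set L : (B →L[ℂ] B) →L[ℂ] ℂ := ℓ.comp (ContinuousLinearMap.apply ℂ B one) with hL
  have hLa : ∀ S, L S = ℓ (S one) := fun S => rfl
  set κ : ℝ × ℂ → ℂ := fun p => L (R p * R p) with hκ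
  set Q : ℝ × ℂ → B →L[ℂ] B := fun p => (κ p)⁻¹ • (R p * E₁ * R p) with hQ
  have hκ0 : κ p₀ = 1 := by simp [hκ, hRp₀, hLa, hR₀1, h1]
  have hQ0 : Q p₀ = E₁ := by
    ext b
    simp [hQ, hκ0, hRp₀, hE, hR₀1, hR₀l]
  have hκd : DifferentiableAt ℝ κ p₀ :=
    ((L.restrictScalars ℝ).differentiableAt).comp p₀ (hRd.mul hRd)
  have hQd : DifferentiableAt ℝ Q p₀ :=
    (hκd.inv (by simp [hκ0])).smul ((hRd.mul_const E₁).mul hRd)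
  set M : ℝ × ℂ → B →L[ℂ] B := fun p => P p.1 - p.2 • Q p with hM
  have hM0 : M p₀ = P 0 - E₁ := by simp only [hM, hQ0]; simp [hp₀]
  have hMc : ContinuousAt M p₀ := by
    have e1 : ContinuousAt (fun p : ℝ × ℂ => P p.1) p₀ :=
      ContinuousAt.comp (f := Prod.fst) (x := p₀) hP.continuousAt continuousAt_fst
    exact e1.sub (continuousAt_snd.smul hQd.continuousAt)
  obtain ⟨C₀, θ, hC₀, hθ0, hθ1, hpow⟩ := eventually_norm_pow_le_of_spectralRadius_lt_one hρ
  rw [← hM0] at hpow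
  -- the filter of solutions `(t, μ)` of the eigenvalue equation near `(0, 1)`
  set F : Filter (ℝ × ℂ) := 𝓝 p₀ ⊓ 𝓟 {p | ℓ (R p one) = p.2} with hF
  have hFle : F ≤ 𝓝 p₀ := inf_le_left
  have hF1 : Tendsto (fun p : ℝ × ℂ => p.1) F (𝓝 0) := (continuous_fst.tendsto p₀).mono_left hFle
  have hF2 : Tendsto (fun p : ℝ × ℂ => p.2) F (𝓝 1) := (continuous_snd.tendsto p₀).mono_left hFle
  have hFi : Tendsto (fun p : ℝ × ℂ => p.2⁻¹) F (𝓝 1) := by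
    simpa using hF2.inv₀ one_ne_zero
  -- All asymptotics are proved along `F`, with `μ` an independent coordinate, so no branch `t ↦
  -- μ(t)` has to be chosen or shown regular.
  have transfer : ∀ {q : ℝ × ℂ → Prop}, (∀ᶠ p in F, q p) → ∀ᶠ t in 𝓝 (0 : ℝ), ∃ μ, q (t, μ) := by
    intro q hq
    rw [hF, eventually_inf_principal] at hq
    filter_upwards [exists_eigenvalue_near_one hNd h1 hN1 hu hq] with t ht
    obtain ⟨μ, hμ1, hμ2⟩ := ht
    exact ⟨μ, hμ1 hμ2⟩
  have hunit : ∀ᶠ p in F, IsUnit (1 - p.2⁻¹ • N p.1) := by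
    refine hFle ?_
    have c : ContinuousAt (fun p : ℝ × ℂ => 1 - p.2⁻¹ • N p.1) p₀ := by
      have e1 : ContinuousAt (fun p : ℝ × ℂ => N p.1) p₀ :=
        ContinuousAt.comp (f := Prod.fst) (x := p₀) hNd.continuousAt continuousAt_fst
      have e2 : ContinuousAt (fun p : ℝ × ℂ => p.2⁻¹) p₀ :=
        continuousAt_snd.inv₀ (by simp [hp₀])
      exact continuousAt_const.sub (e2.smul e1)
    exact c.preimage_mem_nhds (Units.isOpen.mem_nhds (by simpa [hp₀] using hu))
  have hF2ne : ∀ᶠ p in F, p.2 ≠ 0 := hF2.eventually_ne one_ne_zero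
  have hκne : ∀ᶠ p in F, κ p ≠ 0 :=
    (hκd.continuousAt.tendsto.mono_left hFle).eventually_ne (by simp [hκ0])
  have hsol : ∀ᶠ p in F, ℓ (R p one) = p.2 := mem_inf_of_right (mem_principal_self _)
  -- orders of magnitude along `F`
  set D : ℝ × ℂ → B →L[ℂ] B := fun p => P p.1 - P 0 with hD
  set P' := deriv P 0 with hP'
  have oR : R =O[F] fun _ => (1 : ℝ) :=
    ((hRd.continuousAt.tendsto).mono_left hFle).isBigO_one ℝ
  have oi : (fun p : ℝ × ℂ => p.2⁻¹) =O[F] fun _ => (1 : ℝ) := hFi.isBigO_one ℝ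
  have oii : (fun p : ℝ × ℂ => p.2⁻¹ ^ 2) =O[F] fun _ => (1 : ℝ) := by
    simpa using oi.pow 2
  have oD2 : (fun p => D p - p.1 • P') =O[F] fun p => p.1 ^ 2 :=
    hP.isBigO_sub_sub_smul_deriv.comp_tendsto hF1
  have oD : D =O[F] fun p => p.1 := by
    have := ((hP.differentiableAt (by simp)).isBigO_sub).comp_tendsto hF1
    simpa [Function.comp_def] using this
  have oLd : (fun p => L (D p) + a * (p.1 : ℂ) ^ 2) =o[F] fun p => p.1 ^ 2 := by
    refine (ha.comp_tendsto hF1).congr_left fun p => ?_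
    simp only [Function.comp_apply, hLa, hD, sub_apply, map_sub, hP1, h1]
    ring
  have ot2 : (fun p : ℝ × ℂ => (a : ℂ) * (p.1 : ℂ) ^ 2) =O[F] fun p => p.1 ^ 2 := by
    refine Asymptotics.IsBigO.of_bound |a| (Eventually.of_forall fun p => ?_)
    simp
  -- The expansion `ha` has no linear term; this is why `μ - 1` turns out to be `O(t²)` although `D`
  -- is only `O(t)`.
  have oLD : (fun p => L (D p)) =O[F] fun p => p.1 ^ 2 :=
    (oLd.isBigO.sub ot2).congr_left fun p => by ring
  have oDRD : (fun p => D p * R p * D p) =O[F] fun p => p.1 ^ 2 :=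
    ((oD.mul oR).mul oD).congr_right fun p => by ring
  have oLDRD : (fun p => L (D p * R p * D p)) =O[F] fun p => p.1 ^ 2 :=
    (L.isBigO_comp _ F).trans oDRD
  have heq : ∀ᶠ p in F, p.2 = 1 + p.2⁻¹ * L (D p) + p.2⁻¹ ^ 2 * L (D p * R p * D p) := by
    filter_upwards [hunit, hsol] with p hp1 hp2
    have hNp : N p.1 = N 0 + D p := by simp only [hN, hD]; abel
    have := resolvent_expansion (ℓ := ℓ) (one := one) (N₀ := N 0) (D := D p) (R := R p)
      (μ := p.2) (by rw [← hNp]; exact Ring.mul_inverse_cancel _ hp1)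
      (by rw [← hNp]; exact Ring.inverse_mul_cancel _ hp1) hN1 hNl
    rw [hp2, h1] at this
    exact this
  have oμ : (fun p : ℝ × ℂ => p.2 - 1) =O[F] fun p => p.1 ^ 2 := by
    have e1 := ((oi.mul oLD).add (oii.mul oLDRD)).congr_right
      (g₂ := fun p : ℝ × ℂ => p.1 ^ 2) fun p => by simp
    refine e1.congr' ?_ EventuallyEq.rfl
    filter_upwards [heq] with p hp
    linear_combination -hp
  have ot21 : (fun p : ℝ × ℂ => p.1 ^ 2) =O[F] fun p => p.1 := by
    have := (hF1.isBigO_one ℝ).mul (Asymptotics.isBigO_refl (fun p : ℝ × ℂ => p.1) F)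
    refine this.congr (fun p => by ring) fun p => by simp
  have op : (fun p : ℝ × ℂ => p - p₀) =O[F] fun p => p.1 := by
    refine Asymptotics.IsBigO.prod_left ?_ ?_
    · simpa [hp₀] using Asymptotics.isBigO_refl (fun p : ℝ × ℂ => p.1) F
    · simpa [hp₀] using oμ.trans ot21
  have oRR : (fun p => R p - R₀) =O[F] fun p => p.1 := by
    have := (hRd.isBigO_sub.mono hFle).trans op
    rwa [hRp₀] at this
  have oQQ : (fun p => Q p - E₁) =O[F] fun p => p.1 := by
    have := (hQd.isBigO_sub.mono hFle).trans op
    rwa [hQ0] at this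
  have otP : (fun p : ℝ × ℂ => p.1 • P') =O[F] fun p => p.1 := by
    refine Asymptotics.IsBigO.of_bound ‖P'‖ (Eventually.of_forall fun p => ?_)
    rw [norm_smul, mul_comm]
  have oc : (fun _ : ℝ × ℂ => R₀) =O[F] fun _ => (1 : ℝ) := Asymptotics.isBigO_const_const _ one_ne_zero _
  -- Replace the left `D` by `t P'`, then `R` by `R₀`, then the right `D` by `t P'`; each
  -- replacement costs one extra power of `t`.
  have oe : (fun p => D p * R p * D p - p.1 ^ 2 • (P' * R₀ * P')) =O[F] fun p => p.1 ^ 3 := by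
    have e1 := ((oD2.mul oR).mul oD).congr_right (g₂ := fun p : ℝ × ℂ => p.1 ^ 3) fun p => by ring
    have e2 := ((otP.mul oRR).mul oD).congr_right (g₂ := fun p : ℝ × ℂ => p.1 ^ 3)
      fun p => by ring
    have e3 := ((otP.mul oc).mul oD2).congr_right (g₂ := fun p : ℝ × ℂ => p.1 ^ 3)
      fun p => by ring
    refine ((e1.add e2).add e3).congr_left fun p => ?_
    simp only [sub_mul, mul_sub, smul_mul_assoc, mul_smul_comm, smul_smul, pow_two]
    abel
  set k : ℂ := L (P' * R₀ * P') with hk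
  have hkim : k.im = 0 := hreal
  have oLe : (fun p => L (D p * R p * D p) - (p.1 : ℂ) ^ 2 * k) =O[F] fun p => p.1 ^ 3 := by
    refine ((L.isBigO_comp _ F).trans oe).congr_left fun p => ?_
    rw [map_sub, hk]
    congr 1
    rw [← Complex.coe_smul, map_smul]
    simp
  have oi1 : (fun p : ℝ × ℂ => p.2⁻¹ - 1) =O[F] fun p => p.1 := by
    have e1 := (oi.mul (oμ.trans ot21)).neg_left.congr_right (g₂ := fun p : ℝ × ℂ => p.1)
      fun p => by simp
    refine e1.congr' ?_ EventuallyEq.rfl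
    filter_upwards [hF2ne] with p hp
    field_simp
    ring
  have oi2 : (fun p : ℝ × ℂ => p.2⁻¹ ^ 2 - 1) =O[F] fun p => p.1 := by
    have e1 : (fun p : ℝ × ℂ => p.2⁻¹ + 1) =O[F] fun _ => (1 : ℝ) :=
      (hFi.add_const 1).isBigO_one ℝ
    refine (oi1.mul e1).congr (fun p => by ring) fun p => by simp
  -- The term `L (D p)` is kept exact, since it is controlled only to `o(t²)` beyond its quadratic
  -- part. As `k` is real, imaginary parts give `Im μ = Im ℓ(P(t) 1) + O(t³)`.
  have oμ3 : (fun p : ℝ × ℂ => p.2 - 1 - L (D p) - (p.1 : ℂ) ^ 2 * k) =O[F] fun p => p.1 ^ 3 := by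
    have e1 := (oi1.mul oLD).congr_right (g₂ := fun p : ℝ × ℂ => p.1 ^ 3) fun p => by ring
    have e2 := (oi2.mul oLDRD).congr_right (g₂ := fun p : ℝ × ℂ => p.1 ^ 3) fun p => by ring
    refine ((e1.add e2).add oLe).congr' ?_ EventuallyEq.rfl
    filter_upwards [heq] with p hp
    linear_combination -hp
  have ot32 : (fun p : ℝ × ℂ => p.1 ^ 3) =o[F] fun p => p.1 ^ 2 := by
    have e1 : (fun p : ℝ × ℂ => p.1) =o[F] fun _ => (1 : ℝ) :=
      (Asymptotics.isLittleO_one_iff ℝ).2 hF1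
    refine (e1.mul_isBigO (Asymptotics.isBigO_refl (fun p : ℝ × ℂ => p.1 ^ 2) F)).congr
      (fun p => by ring) fun p => by simp
  have oμ2 : (fun p : ℝ × ℂ => p.2 - 1 + ((a - k.re : ℝ) : ℂ) * (p.1 : ℂ) ^ 2) =o[F]
      fun p => p.1 ^ 2 := by
    refine ((oμ3.trans_isLittleO ot32).add oLd).congr_left fun p => ?_
    have : k = (k.re : ℂ) := by apply Complex.ext <;> simp [hkim]
    rw [this]
    push_cast
    simp only [Complex.ofReal_re]
    ring
  obtain ⟨C₁, hC₁⟩ := oμ3.bound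
  obtain ⟨C₂, hC₂⟩ := oQQ.bound
  set C : ℝ := |C₁| + ‖ℓ‖ * |C₂| * C₀ * |C₂| * ‖one‖ with hC
  have hCC : 0 ≤ ‖ℓ‖ * |C₂| * C₀ * |C₂| * ‖one‖ := by positivity
  -- `s` combines the variance term `a` of one step with the correlation term `k`. In `C`, the first
  -- summand serves `Im μ` and the second the remainder.
  refine ⟨a - k.re, C, θ, by positivity, hθ0, hθ1, fun ε hε => ?_⟩
  have hfin : ∀ᶠ p in F, ∃ c : ℂ,
      ‖p.2 - 1 + ((a - k.re : ℝ) : ℂ) * (p.1 : ℂ) ^ 2‖ ≤ ε * p.1 ^ 2 ∧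
      |p.2.im| ≤ |(ℓ (P p.1 one)).im| + C * |p.1| ^ 3 ∧
      ‖c - 1‖ ≤ C * p.1 ^ 2 ∧ ∀ n : ℕ, ‖ℓ ((P p.1 ^ n) one) - c * p.2 ^ n‖ ≤
        C * p.1 ^ 2 * θ ^ n := by
    filter_upwards [oμ2.bound hε, hC₁, hC₂, hunit, hsol, hκne, hF2ne, hFle (hMc.eventually hpow)] with
      p q1 q2 q3 q4 q5 q6 q7 q8
    have hPp : E₁ + N p.1 = P p.1 := by simp only [hN]; abel
    obtain ⟨r1, r2, r3⟩ := rankOne_add_eigenprojection (ℓ := ℓ) (one := one) (N := N p.1)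
      (R := R p) (μ := p.2) q7 (Ring.mul_inverse_cancel _ q4) (Ring.inverse_mul_cancel _ q4) q5
      q6 (Q := Q p) rfl
    rw [← hE, hPp] at r1 r2
    have key : ∀ n : ℕ, ‖ℓ ((P p.1 ^ n) one) - L (Q p) * p.2 ^ n‖ ≤ C * p.1 ^ 2 * θ ^ n := by
      intro n
      have e1 := pow_eq_smul_add_mul r1 r2 r3 n
      -- Because `ℓ ∘ E₁ = ℓ` and `E₁ one = one`, each `1 - Q` may be replaced by `E₁ - Q`, which is
      -- `O(t)`; the two signs cancel.
      have e2 : ℓ ((P p.1 ^ n) one) - L (Q p) * p.2 ^ n =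
          ℓ ((Q p - E₁) ((M p ^ n) ((Q p - E₁) one))) := by
        rw [e1]
        simp only [add_apply, smul_apply, mul_apply_eq_comp, sub_apply, one_apply_eq_self,
          map_add, map_sub, map_smul, smul_eq_mul, hLa, hE, hM,
          ContinuousLinearMap.smulRight_apply, h1, one_smul, mul_one]
        ring
      rw [e2]
      have e3 : ‖(Q p - E₁)‖ ≤ |C₂| * |p.1| := by
        refine q3.trans ?_
        rw [Real.norm_eq_abs]
        gcongr
        exact le_abs_self _
      calc ‖ℓ ((Q p - E₁) ((M p ^ n) ((Q p - E₁) one)))‖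
          ≤ ‖ℓ‖ * (‖Q p - E₁‖ * (‖M p ^ n‖ * (‖Q p - E₁‖ * ‖one‖))) := by
            refine (ℓ.le_opNorm _).trans ?_
            gcongr
            refine ((Q p - E₁).le_opNorm _).trans ?_
            gcongr
            refine ((M p ^ n).le_opNorm _).trans ?_
            gcongr
            exact (Q p - E₁).le_opNorm _
        _ ≤ ‖ℓ‖ * ((|C₂| * |p.1|) * ((C₀ * θ ^ n) * ((|C₂| * |p.1|) * ‖one‖))) := by
            gcongr
            exact q8 n
        _ = ‖ℓ‖ * |C₂| * C₀ * |C₂| * ‖one‖ * p.1 ^ 2 * θ ^ n := by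
            rw [← sq_abs p.1]; ring
        _ ≤ C * p.1 ^ 2 * θ ^ n := by
            gcongr
            rw [hC]; linarith [abs_nonneg C₁]
    refine ⟨L (Q p), ?_, ?_, ?_, key⟩
    · simpa using q1
    · have e1 : (p.2 - 1 - L (D p) - (p.1 : ℂ) ^ 2 * k).im = p.2.im - (ℓ (P p.1 one)).im := by
        rw [← Complex.ofReal_pow, Complex.sub_im, Complex.im_ofReal_mul, hkim]
        simp [hLa, hD, hP1, h1]
      have e2 := (Complex.abs_im_le_norm _).trans q2
      rw [e1, norm_pow, Real.norm_eq_abs] at e2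
      have e3 : C₁ * |p.1| ^ 3 ≤ C * |p.1| ^ 3 := by
        gcongr
        rw [hC]; linarith [le_abs_self C₁]
      have e4 := abs_sub_abs_le_abs_sub p.2.im (ℓ (P p.1 one)).im
      linarith
    -- At `n = 0` the remainder estimate is exactly the bound on `c - 1`.
    · have := key 0
      simp only [pow_zero, one_apply_eq_self, h1, mul_one] at this
      rwa [norm_sub_rev]
  filter_upwards [transfer hfin] with t ht
  exact ht

end Perturbation

/-! ### Geometric sums and powers of complex numbers -/

theorem sum_geometric_le {q : ℝ} (h0 : 0 ≤ q) (h1 : q < 1) (n : ℕ) :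
    ∑ j ∈ Finset.range n, q ^ j ≤ (1 - q)⁻¹ := by
  rw [← tsum_geometric_of_lt_one h0 h1]
  exact (summable_geometric_of_lt_one h0 h1).sum_le_tsum _ fun _ _ => by positivity

theorem sum_succ_mul_geometric_le {q : ℝ} (h0 : 0 ≤ q) (h1 : q < 1) (n : ℕ) :
    ∑ j ∈ Finset.range n, ((j : ℝ) + 1) * q ^ j ≤ (1 - q)⁻¹ ^ 2 := by
  have e : (1 - q) * ∑ j ∈ Finset.range n, ((j : ℝ) + 1) * q ^ j + n * q ^ n =
      ∑ j ∈ Finset.range n, q ^ j := by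
    induction n with
    | zero => simp
    | succ n ih =>
      rw [Finset.sum_range_succ, Finset.sum_range_succ, ← ih]
      push_cast
      ring
  have h2 : (1 - q) * ∑ j ∈ Finset.range n, ((j : ℝ) + 1) * q ^ j ≤ (1 - q)⁻¹ := by
    have : 0 ≤ (n : ℝ) * q ^ n := by positivity
    linarith [sum_geometric_le h0 h1 n]
  have h3 : 0 < 1 - q := by linarith
  rw [pow_two, ← div_eq_inv_mul, le_div_iff₀ h3, mul_comm]
  exact h2

/-- The factor `|z.im|` must survive: bounding the imaginary part of `μ ^ n` by its norm would lose
the smallness of `Im μ`. -/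
theorem Complex.abs_im_pow_succ_le (z : ℂ) (n : ℕ) :
    |(z ^ (n + 1)).im| ≤ (n + 1) * ‖z‖ ^ n * |z.im| := by
  induction n with
  | zero => simp
  | succ n ih =>
    rw [pow_succ, Complex.mul_im]
    refine (abs_add_le _ _).trans ?_
    rw [abs_mul, abs_mul]
    have h1 : |(z ^ (n + 1)).re| ≤ ‖z‖ ^ (n + 1) := by
      rw [← norm_pow]; exact Complex.abs_re_le_norm _
    have h2 := Complex.abs_re_le_norm z
    calc |(z ^ (n + 1)).re| * |z.im| + |(z ^ (n + 1)).im| * |z.re|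
        ≤ ‖z‖ ^ (n + 1) * |z.im| + ((n + 1) * ‖z‖ ^ n * |z.im|) * ‖z‖ := by gcongr
      _ = _ := by push_cast; ring

theorem norm_one_sub_pow_le {z : ℂ} (hz : ‖z‖ ≤ 1) (n : ℕ) : ‖1 - z ^ n‖ ≤ n * ‖1 - z‖ := by
  induction n with
  | zero => simp
  | succ n ih =>
    have e : 1 - z ^ (n + 1) = (1 - z ^ n) + z ^ n * (1 - z) := by ring
    rw [e]
    refine (norm_add_le _ _).trans ?_
    rw [norm_mul, norm_pow]
    have : ‖z‖ ^ n * ‖1 - z‖ ≤ 1 * ‖1 - z‖ := by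
      gcongr
      exact pow_le_one₀ (norm_nonneg _) hz
    push_cast
    linarith

/-! ### Positivity of the variance and sums of characteristic functions -/

/-- Nondegeneracy of the variance: characteristic functions that tend to zero off the origin
cannot have a degenerate quadratic expansion. -/
theorem variance_pos_of_tendsto_zero {χ : ℕ → ℝ → ℂ} {s C θ : ℝ} (hC : 0 ≤ C) (hθ0 : 0 < θ)
    (hθ1 : θ < 1) (hχ0 : ∀ t ≠ 0, Tendsto (fun n => χ n t) atTop (𝓝 0))
    (hdouble : ∀ n t, 1 - (χ n (2 * t)).re ≤ 4 * (1 - (χ n t).re))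
    (hexp : ∀ ε > 0, ∀ᶠ t : ℝ in 𝓝 0, ∃ μ c : ℂ, ‖μ - 1 + s * t ^ 2‖ ≤ ε * t ^ 2 ∧
      ‖c - 1‖ ≤ C * t ^ 2 ∧ ∀ n : ℕ, ‖χ n t - c * μ ^ n‖ ≤ C * t ^ 2 * θ ^ n) :
    0 < s := by
  have hsmall : ∀ᶠ t : ℝ in 𝓝 0, C * t ^ 2 < 1 / 2 := by
    have : Tendsto (fun t : ℝ => C * t ^ 2) (𝓝 0) (𝓝 (C * 0 ^ 2)) :=
      (by fun_prop : Continuous fun t : ℝ => C * t ^ 2).tendsto 0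
    exact this.eventually_lt_const (by norm_num)
  -- If `‖μ‖ ≥ 1`, then `c * μ ^ n` would stay above `1/2` in norm, against `χ n t → 0`.
  have hlt : ∀ ε > 0, ∀ᶠ t : ℝ in 𝓝[≠] 0, ∃ μ c : ℂ, ‖μ‖ < 1 ∧ ‖μ - 1 + s * t ^ 2‖ ≤ ε * t ^ 2 ∧
      ‖c - 1‖ ≤ C * t ^ 2 ∧ ∀ n : ℕ, ‖χ n t - c * μ ^ n‖ ≤ C * t ^ 2 * θ ^ n := by
    intro ε hε
    filter_upwards [(hexp ε hε).filter_mono nhdsWithin_le_nhds,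
      hsmall.filter_mono nhdsWithin_le_nhds, self_mem_nhdsWithin] with t ht1 ht2 ht0
    obtain ⟨μ, c, h1, h2, h3⟩ := ht1
    refine ⟨μ, c, ?_, h1, h2, h3⟩
    by_contra! hge
    have hc : 1 / 2 ≤ ‖c‖ := by
      have := norm_sub_norm_le (1 : ℂ) (1 - c)
      rw [norm_sub_rev 1 c, norm_one, sub_sub_cancel] at this
      linarith
    have hlow : ∀ n, 1 / 2 ≤ ‖χ n t‖ + C * t ^ 2 * θ ^ n := fun n => by
      have a1 : 1 / 2 ≤ ‖c * μ ^ n‖ := by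
        rw [norm_mul, norm_pow]
        have : 1 ≤ ‖μ‖ ^ n := one_le_pow₀ hge
        nlinarith
      have a2 := norm_sub_norm_le (c * μ ^ n) (χ n t)
      rw [norm_sub_rev] at a2
      linarith [h3 n]
    have lim : Tendsto (fun n => ‖χ n t‖ + C * t ^ 2 * θ ^ n) atTop (𝓝 (‖(0 : ℂ)‖ + C * t ^ 2 * 0)) :=
      (hχ0 t ht0).norm.add ((tendsto_pow_atTop_nhds_zero_of_lt_one hθ0.le hθ1).const_mul _)
    have := ge_of_tendsto' lim hlow
    norm_num at this
  by_contra! hs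
  rcases hs.lt_or_eq with hs | hs
  -- For `s < 0`, the choice `ε = -s / 2` forces `Re μ > 1`.
  · obtain ⟨t, ⟨μ, c, h1, h2, -⟩, ht0⟩ := ((hlt (-s / 2) (by linarith)).and
      (self_mem_nhdsWithin : {(0 : ℝ)}ᶜ ∈ 𝓝[≠] 0)).exists
    have ht2 : 0 < t ^ 2 := by
      have : t ≠ 0 := ht0
      positivity
    have h3 := (Complex.abs_re_le_norm _).trans h2
    have h4 : (μ - 1 + s * t ^ 2 : ℂ).re = μ.re - 1 + s * t ^ 2 := by
      rw [← Complex.ofReal_pow, ← Complex.ofReal_mul]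
      simp only [Complex.add_re, Complex.sub_re, Complex.ofReal_re, Complex.one_re]
    rw [h4] at h3
    have h5 := (Complex.re_le_norm μ).trans_lt h1
    have h6 := (abs_le.1 h3).1
    nlinarith
  · subst hs
    -- With `s = 0` and `ε = 1 / (n + 1)`, the `n` factors in `1 - μ ^ n` cost at most `t²`. The
    -- constant does not depend on `n`, though the neighbourhood does.
    have hloc : ∀ n, ∀ᶠ t : ℝ in 𝓝[≠] 0, 1 - (χ n t).re ≤ (2 * C + 1) * t ^ 2 := by
      intro n
      filter_upwards [hlt (1 / (n + 1)) (by positivity)] with t ht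
      obtain ⟨μ, c, h1, h2, h3, h4⟩ := ht
      have a1 : 1 - (χ n t).re ≤ ‖1 - χ n t‖ := by
        have := Complex.re_le_norm (1 - χ n t)
        simpa using this
      have a2 : ‖1 - χ n t‖ ≤ ‖1 - μ ^ n‖ + ‖(c - 1) * μ ^ n‖ + ‖χ n t - c * μ ^ n‖ := by
        have : 1 - χ n t = (1 - μ ^ n) - (c - 1) * μ ^ n - (χ n t - c * μ ^ n) := by ring
        rw [this]
        exact (norm_sub_le _ _).trans (by gcongr; exact norm_sub_le _ _)
      have a3 : ‖1 - μ ^ n‖ ≤ t ^ 2 := by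
        refine (norm_one_sub_pow_le h1.le n).trans ?_
        have h2' : ‖1 - μ‖ ≤ 1 / (n + 1) * t ^ 2 := by
          rw [norm_sub_rev]; simpa using h2
        calc (n : ℝ) * ‖1 - μ‖ ≤ n * (1 / (n + 1) * t ^ 2) := by gcongr
          _ = (n / (n + 1)) * t ^ 2 := by ring
          _ ≤ 1 * t ^ 2 := by
            gcongr
            rw [div_le_one (by positivity)]; linarith
          _ = t ^ 2 := one_mul _
      have a4 : ‖(c - 1) * μ ^ n‖ ≤ C * t ^ 2 := by
        rw [norm_mul, norm_pow]
        exact (mul_le_of_le_one_right (norm_nonneg _)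
          (pow_le_one₀ (norm_nonneg _) h1.le)).trans h3
      have a5 : ‖χ n t - c * μ ^ n‖ ≤ C * t ^ 2 :=
        (h4 n).trans (mul_le_of_le_one_right (by positivity) (pow_le_one₀ hθ0.le hθ1.le))
      linarith
    -- The loss of `4` per doubling matches the scaling of `t²`, so the local bound spreads to every
    -- `t ≠ 0` with the same constant and the `n`-dependent neighbourhood disappears.
    have hglob : ∀ n, ∀ t ≠ 0, 1 - (χ n t).re ≤ (2 * C + 1) * t ^ 2 := by
      intro n t ht
      have iter : ∀ (k : ℕ) (u : ℝ), 1 - (χ n (2 ^ k * u)).re ≤ 4 ^ k * (1 - (χ n u).re) := by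
        intro k
        induction k with
        | zero => intro u; simp
        | succ k ih =>
          intro u
          calc 1 - (χ n (2 ^ (k + 1) * u)).re = 1 - (χ n (2 * (2 ^ k * u))).re := by
                congr 3; ring
            _ ≤ 4 * (1 - (χ n (2 ^ k * u)).re) := hdouble _ _
            _ ≤ 4 * (4 ^ k * (1 - (χ n u).re)) := by gcongr; exact ih u
            _ = _ := by ring
      have lim : Tendsto (fun k : ℕ => (1 / 2 : ℝ) ^ k * t) atTop (𝓝[≠] 0) := by
        refine tendsto_nhdsWithin_iff.2 ⟨?_, Eventually.of_forall fun k => ?_⟩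
        · simpa using (tendsto_pow_atTop_nhds_zero_of_lt_one (r := (1 / 2 : ℝ)) (by norm_num)
            (by norm_num)).mul_const t
        · exact mul_ne_zero (by positivity) ht
      obtain ⟨k, hk⟩ := (lim.eventually (hloc n)).exists
      have h2 := iter k ((1 / 2 : ℝ) ^ k * t)
      have e1 : (2 : ℝ) ^ k * ((1 / 2 : ℝ) ^ k * t) = t := by
        rw [← mul_assoc, ← mul_pow]; norm_num
      rw [e1] at h2
      refine h2.trans ?_
      calc (4 : ℝ) ^ k * (1 - (χ n ((1 / 2 : ℝ) ^ k * t)).re)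
          ≤ 4 ^ k * ((2 * C + 1) * ((1 / 2 : ℝ) ^ k * t) ^ 2) := by gcongr
        _ = (4 * (1 / 2) * (1 / 2)) ^ k * ((2 * C + 1) * t ^ 2) := by
            rw [mul_pow, mul_pow, mul_pow]; ring
        _ = _ := by norm_num
    have hone : ∀ t : ℝ, t ≠ 0 → 1 ≤ (2 * C + 1) * t ^ 2 := by
      intro t ht
      have lim : Tendsto (fun n => 1 - (χ n t).re) atTop (𝓝 (1 - (0 : ℂ).re)) :=
        ((Complex.continuous_re.tendsto _).comp (hχ0 t ht)).const_sub 1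
      have := le_of_tendsto' lim fun n => hglob n t ht
      simpa using this
    -- Letting `n → ∞` gave `1 ≤ (2C + 1) t²` for all `t ≠ 0`, which fails for this small `t`.
    have h := hone (1 / (2 * C + 2)) (by positivity)
    rw [div_pow, one_pow, mul_one_div, le_div_iff₀ (by positivity)] at h
    nlinarith

/-- Bounds near zero for sums of characteristic functions with a spectral expansion. -/
theorem exists_sum_bounds_near_zero {χ : ℕ → ℝ → ℂ} {s C θ : ℝ} (hs : 0 < s) (hC : 0 ≤ C)
    (hθ0 : 0 < θ) (hθ1 : θ < 1)
    (hexp : ∀ ε > 0, ∀ᶠ t : ℝ in 𝓝 0, ∃ μ c : ℂ, ‖μ - 1 + s * t ^ 2‖ ≤ ε * t ^ 2 ∧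
      |μ.im| ≤ |(χ 1 t).im| + C * |t| ^ 3 ∧
      ‖c - 1‖ ≤ C * t ^ 2 ∧ ∀ n : ℕ, ‖χ n t - c * μ ^ n‖ ≤ C * t ^ 2 * θ ^ n) :
    ∃ δ K : ℝ, 0 < δ ∧ 0 ≤ K ∧ ∀ t : ℝ, t ≠ 0 → |t| < δ → ∀ n,
      t ^ 2 * ∑ j ∈ Finset.range n, ‖χ (j + 1) t‖ ≤ K ∧
      |t| * ∑ j ∈ Finset.range n, |(χ (j + 1) t).im| ≤ K * (|(χ 1 t).im| / |t| ^ 3 + 1) := by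
  have hsmall : ∀ᶠ t : ℝ in 𝓝 0, s * t ^ 2 < 1 := by
    have : Tendsto (fun t : ℝ => s * t ^ 2) (𝓝 0) (𝓝 (s * 0 ^ 2)) :=
      (by fun_prop : Continuous fun t : ℝ => s * t ^ 2).tendsto 0
    exact this.eventually_lt_const (by norm_num)
  -- `ε = s / 2` leaves the gap `‖μ‖ ≤ 1 - (s / 2) t²`, and `s t² < 1` keeps `1 - s t²` positive in
  -- the triangle inequality.
  obtain ⟨δ₀, hδ₀, hball⟩ := Metric.eventually_nhds_iff.1
    ((hexp (s / 2) (by linarith)).and hsmall)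
  set b : ℝ := 2 / s with hb
  have hb0 : 0 < b := by positivity
  set g : ℝ := (1 - θ)⁻¹ with hg
  have hg0 : 0 < g := by rw [hg]; have : 0 < 1 - θ := by linarith
                         positivity
  refine ⟨min δ₀ 1, (1 + C) * b + C * g + (b ^ 2 + C * b ^ 2 + C * b + C * g),
    lt_min hδ₀ one_pos, by positivity, fun t ht0 htδ n => ?_⟩
  have ht1 : |t| ≤ 1 := htδ.le.trans (min_le_right _ _)
  have htp : 0 < |t| := abs_pos.2 ht0
  obtain ⟨⟨μ, c, h1, h2, h3, h4⟩, h5⟩ := hball (y := t)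
    (by simpa using htδ.trans_le (min_le_left _ _))
  have ht2p : 0 < t ^ 2 := by positivity
  have ht21 : t ^ 2 ≤ 1 := by rw [← sq_abs]; exact pow_le_one₀ htp.le ht1
  have hμ : ‖μ‖ ≤ 1 - s / 2 * t ^ 2 := by
    have e1 : μ = (μ - 1 + s * t ^ 2) + ((1 - s * t ^ 2 : ℝ) : ℂ) := by push_cast; ring
    rw [e1]
    refine (norm_add_le _ _).trans ?_
    rw [Complex.norm_real, Real.norm_of_nonneg (by linarith)]
    linarith
  have hgap : 0 < s / 2 * t ^ 2 := by positivity
  have hμ1 : ‖μ‖ < 1 := by linarith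
  have hinv : (1 - ‖μ‖)⁻¹ ≤ b / t ^ 2 := by
    have e1 : b / t ^ 2 = (s / 2 * t ^ 2)⁻¹ := by rw [hb]; field_simp
    rw [e1]
    exact inv_anti₀ hgap (by linarith)
  have hS1 : ∑ j ∈ Finset.range n, ‖μ‖ ^ j ≤ b / t ^ 2 :=
    (sum_geometric_le (norm_nonneg _) hμ1 n).trans hinv
  have hS1' : ∑ j ∈ Finset.range n, ‖μ‖ ^ (j + 1) ≤ b / t ^ 2 := by
    refine le_trans (Finset.sum_le_sum fun j _ => ?_) hS1
    exact pow_le_pow_of_le_one (norm_nonneg _) hμ1.le (Nat.le_succ j)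
  have hS2 : ∑ j ∈ Finset.range n, ((j : ℝ) + 1) * ‖μ‖ ^ j ≤ (b / t ^ 2) ^ 2 := by
    refine (sum_succ_mul_geometric_le (norm_nonneg _) hμ1 n).trans ?_
    have : 0 ≤ (1 - ‖μ‖)⁻¹ := inv_nonneg.2 (by linarith)
    gcongr
  have hS3 : ∑ j ∈ Finset.range n, θ ^ (j + 1) ≤ g := by
    refine le_trans (Finset.sum_le_sum fun j _ => ?_) (sum_geometric_le hθ0.le hθ1 n)
    exact pow_le_pow_of_le_one hθ0.le hθ1.le (Nat.le_succ j)
  have hcn : ‖c‖ ≤ 1 + C := by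
    have := norm_add_le (c - 1) 1
    rw [sub_add_cancel, norm_one] at this
    nlinarith
  have t1 : ∀ j, ‖χ (j + 1) t‖ ≤ (1 + C) * ‖μ‖ ^ (j + 1) + C * t ^ 2 * θ ^ (j + 1) := fun j => by
    have a1 := norm_add_le (χ (j + 1) t - c * μ ^ (j + 1)) (c * μ ^ (j + 1))
    rw [sub_add_cancel] at a1
    have a2 : ‖c * μ ^ (j + 1)‖ ≤ (1 + C) * ‖μ‖ ^ (j + 1) := by
      rw [norm_mul, norm_pow]; gcongr
    linarith [h4 (j + 1)]
  have t2 : ∀ j, |(χ (j + 1) t).im| ≤ |μ.im| * (((j : ℝ) + 1) * ‖μ‖ ^ j) +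
      C * t ^ 2 * ‖μ‖ ^ (j + 1) + C * t ^ 2 * θ ^ (j + 1) := fun j => by
    have e1 : χ (j + 1) t = μ ^ (j + 1) + (c - 1) * μ ^ (j + 1) +
        (χ (j + 1) t - c * μ ^ (j + 1)) := by ring
    rw [e1, Complex.add_im, Complex.add_im]
    refine (abs_add_le _ _).trans (add_le_add ((abs_add_le _ _).trans (add_le_add ?_ ?_)) ?_)
    · exact (Complex.abs_im_pow_succ_le μ j).trans_eq (by ring)
    · refine (Complex.abs_im_le_norm _).trans ?_
      rw [norm_mul, norm_pow]; gcongr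
    · exact (Complex.abs_im_le_norm _).trans (h4 _)
  constructor
  · have a1 : ∑ j ∈ Finset.range n, ‖χ (j + 1) t‖ ≤ (1 + C) * (b / t ^ 2) + C * t ^ 2 * g := by
      refine (Finset.sum_le_sum fun j _ => t1 j).trans ?_
      rw [Finset.sum_add_distrib, ← Finset.mul_sum, ← Finset.mul_sum]
      gcongr
    calc t ^ 2 * ∑ j ∈ Finset.range n, ‖χ (j + 1) t‖
        ≤ t ^ 2 * ((1 + C) * (b / t ^ 2) + C * t ^ 2 * g) := by gcongr
      _ = (1 + C) * b + C * g * (t ^ 2 * t ^ 2) := by field_simp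
      _ ≤ (1 + C) * b + C * g * (1 * 1) := by gcongr
      _ ≤ _ := by
        have : 0 ≤ b ^ 2 + C * b ^ 2 + C * b + C * g := by positivity
        linarith
  -- The weighted sum costs `t⁻⁴`. After multiplication by `|t|`, the cubic part of `Im μ` is
  -- bounded and the rest is `|Im χ₁| / |t|³`.
  · have a1 : ∑ j ∈ Finset.range n, |(χ (j + 1) t).im| ≤
        (|(χ 1 t).im| + C * |t| ^ 3) * (b / t ^ 2) ^ 2 + C * t ^ 2 * (b / t ^ 2) +
          C * t ^ 2 * g := by
      refine (Finset.sum_le_sum fun j _ => t2 j).trans ?_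
      rw [Finset.sum_add_distrib, Finset.sum_add_distrib, ← Finset.mul_sum, ← Finset.mul_sum,
        ← Finset.mul_sum]
      gcongr
    set x := |(χ 1 t).im| with hx
    have hx0 : 0 ≤ x := abs_nonneg _
    have a2 : |t| * ∑ j ∈ Finset.range n, |(χ (j + 1) t).im| ≤
        b ^ 2 * (x / |t| ^ 3) + C * b ^ 2 + C * b * |t| + C * g * (|t| * t ^ 2) := by
      refine (mul_le_mul_of_nonneg_left a1 htp.le).trans_eq ?_
      rw [← sq_abs t]
      field_simp
    have a3 : |t| * t ^ 2 ≤ 1 := mul_le_one₀ ht1 ht2p.le ht21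
    have hx3 : 0 ≤ x / |t| ^ 3 := by positivity
    have hCb : C * b * |t| ≤ C * b := mul_le_of_le_one_right (by positivity) ht1
    have hCg : C * g * (|t| * t ^ 2) ≤ C * g := mul_le_of_le_one_right (by positivity) a3
    have h6 : 0 ≤ (1 + C) * b + C * g + (C * b ^ 2 + C * b + C * g) := by positivity
    have h7 : 0 ≤ (1 + C) * b + C * g := by positivity
    nlinarith [mul_nonneg h6 hx3]

/-- Away from the points where the spectral radius reaches one, sums of powers are bounded,
uniformly on compact sets. -/
theorem IsCompact.exists_sum_norm_pow_le {A : Type*} [NormedRing A] [NormedAlgebra ℂ A]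
    [CompleteSpace A] {P : ℝ → A} (hP : Continuous P) {S : Set ℝ} (hS : IsCompact S)
    (hρ : ∀ t ∈ S, spectralRadius ℂ (P t) < 1) :
    ∃ K : ℝ, ∀ t ∈ S, ∀ n : ℕ, ∑ j ∈ Finset.range n, ‖P t ^ (j + 1)‖ ≤ K := by
  refine hS.induction_on (p := fun S => ∃ K : ℝ, ∀ t ∈ S, ∀ n : ℕ,
    ∑ j ∈ Finset.range n, ‖P t ^ (j + 1)‖ ≤ K) ⟨0, by simp⟩ ?_ ?_ ?_
  · rintro s t hst ⟨K, hK⟩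
    exact ⟨K, fun u hu => hK u (hst hu)⟩
  · rintro s t ⟨K, hK⟩ ⟨K', hK'⟩
    refine ⟨max K K', ?_⟩
    rintro u (hu | hu) n
    · exact (hK u hu n).trans (le_max_left _ _)
    · exact (hK' u hu n).trans (le_max_right _ _)
  · intro t ht
    obtain ⟨C, θ, hC, hθ0, hθ1, hev⟩ :=
      eventually_norm_pow_le_of_spectralRadius_lt_one (hρ t ht)
    refine ⟨_, mem_nhdsWithin_of_mem_nhds (hP.continuousAt.preimage_mem_nhds hev),
      C * (1 - θ)⁻¹, fun u hu n => ?_⟩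
    calc ∑ j ∈ Finset.range n, ‖P u ^ (j + 1)‖ ≤ ∑ j ∈ Finset.range n, C * θ ^ j := by
          refine Finset.sum_le_sum fun j _ => (hu (j + 1)).trans ?_
          gcongr C * ?_
          exact pow_le_pow_of_le_one hθ0.le hθ1.le (Nat.le_succ j)
      _ ≤ _ := by
        rw [← Finset.mul_sum]
        gcongr
        exact sum_geometric_le hθ0.le hθ1 n

/-! ### Algebra of the transfer operator -/

section TransferOperator

variable {X : Type*} [MeasurableSpace X] {m : Measure X} {T : X → X}

theorem ae_eq_transferOp_of_setIntegral [IsFiniteMeasure m] (hT : MeasurePreserving T m m)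
    {f h : X → ℂ} (hf : Integrable f m) (hh : Integrable h m)
    (H : ∀ A, MeasurableSet A → ∫ x in A, h x ∂m = ∫ x in T ⁻¹' A, f x ∂m) :
    h =ᵐ[m] transferOp m T f :=
  hh.ae_eq_of_forall_setIntegral_eq _ _ (integrable_transferOp m T f) fun A hA _ => by
    rw [H A hA, setIntegral_transferOp hT hf hA]

theorem transferOp_congr_ae {f g : X → ℂ} (h : f =ᵐ[m] g) : transferOp m T f = transferOp m T g := by
  unfold transferOp
  rw [WithDensityᵥEq.congr_ae h]

theorem transferOp_one [IsFiniteMeasure m] (hT : MeasurePreserving T m m) :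
    transferOp m T (fun _ => 1) =ᵐ[m] fun _ => 1 := by
  refine (ae_eq_transferOp_of_setIntegral hT (integrable_const _) (integrable_const _)
    fun A hA => ?_).symm
  simp [Measure.real, hT.measure_preimage hA.nullMeasurableSet]

theorem transferOp_conj [IsFiniteMeasure m] (hT : MeasurePreserving T m m) {f : X → ℂ}
    (hf : Integrable f m) :
    transferOp m T (fun x => conj (f x)) =ᵐ[m] fun x => conj (transferOp m T f x) := by
  have cint : ∀ {g : X → ℂ}, Integrable g m → Integrable (fun x => conj (g x)) m := fun hg =>
    (Complex.conjCLE.toContinuousLinearMap.integrable_comp hg)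
  refine (ae_eq_transferOp_of_setIntegral hT (cint hf) (cint (integrable_transferOp m T f))
    fun A hA => ?_).symm
  rw [integral_conj, integral_conj, setIntegral_transferOp hT hf hA]

theorem transferOp_neg [IsFiniteMeasure m] (hT : MeasurePreserving T m m) {f : X → ℂ}
    (hf : Integrable f m) :
    transferOp m T (fun x => -f x) =ᵐ[m] fun x => -transferOp m T f x := by
  refine (ae_eq_transferOp_of_setIntegral hT hf.neg (integrable_transferOp m T f).neg
    fun A hA => ?_).symm
  simp only [Pi.neg_apply, integral_neg]
  rw [setIntegral_transferOp hT hf hA]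

theorem integral_transferOp [IsFiniteMeasure m] (hT : MeasurePreserving T m m) {f : X → ℂ}
    (hf : Integrable f m) : ∫ x, transferOp m T f x ∂m = ∫ x, f x ∂m := by
  simpa using setIntegral_transferOp hT hf MeasurableSet.univ

theorem charOp_zero {φ : X → ℝ} (f : X → ℂ) : charOp m T φ 0 f = transferOp m T f := by
  simp [charOp]

theorem measurable_birkhoffSum (hT : Measurable T) {φ : X → ℝ} (hφ : Measurable φ) (n : ℕ) :
    Measurable (birkhoffSum T φ n) := by
  unfold birkhoffSum
  exact Finset.measurable_fun_sum _ fun k _ => hφ.comp (hT.iterate k)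

theorem norm_exp_I_mul_mul (t s : ℝ) : ‖Complex.exp (Complex.I * t * s)‖ = 1 := by
  have : Complex.I * t * s = ((t * s : ℝ) : ℂ) * Complex.I := by push_cast; ring
  rw [this, Complex.norm_exp_ofReal_mul_I]

theorem integrable_exp_I_mul [IsFiniteMeasure m] {S : X → ℝ} (hS : Measurable S) (t : ℝ) :
    Integrable (fun x => Complex.exp (Complex.I * t * S x)) m :=
  Integrable.of_bound (by fun_prop) 1 (Eventually.of_forall fun x => (norm_exp_I_mul_mul _ _).le)

end TransferOperator

/-! ### The operators `P(t)` on the function space -/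

section FunctionSpace


variable {X : Type*} [MeasurableSpace X] {m : Measure X}
  {B : Type*} [NormedAddCommGroup B] [NormedSpace ℂ B] {ι : B →ₗ[ℂ] Lp ℂ ∞ m}
  {T : X → X} {φ : X → ℝ} {P : ℝ → B →L[ℂ] B} {ℓ : B →L[ℂ] ℂ} {one : B}

theorem IsBanachFunctionSpace.ext_ae [CompleteSpace B] (hB : IsBanachFunctionSpace m ι) {b b' : B}
    (h : ι b =ᵐ[m] ι b') : b = b' :=
  hB.injective (Lp.ext h)

/-- Injectivity of `ι` makes the chosen conjugates unique, hence conjugate-linear in `b`. This real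
structure is used to show that the second order coefficient is real. -/
theorem IsBanachFunctionSpace.exists_conj [CompleteSpace B] (hB : IsBanachFunctionSpace m ι) :
    ∃ J : B →ₛₗ[starRingEnd ℂ] B, ∀ b, ∀ᵐ x ∂m, ι (J b) x = conj (ι b x) := by
  choose J hJ using hB.conj_mem
  refine ⟨{ toFun := J, map_add' := fun a b => ?_, map_smul' := fun c b => ?_ }, hJ⟩
  · refine hB.ext_ae ?_
    rw [map_add]
    have h1 := hJ (a + b)
    rw [map_add] at h1
    filter_upwards [h1, hJ a, hJ b, Lp.coeFn_add (ι (J a)) (ι (J b)),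
      Lp.coeFn_add (ι a) (ι b)] with x h1 h2 h3 h4 h5
    rw [h1, h4, h5, Pi.add_apply, Pi.add_apply, map_add, h2, h3]
  · refine hB.ext_ae ?_
    rw [map_smul]
    have h1 := hJ (c • b)
    rw [map_smul] at h1
    filter_upwards [h1, hJ b, Lp.coeFn_smul (conj c) (ι (J b)), Lp.coeFn_smul c (ι b)]
      with x h1 h2 h3 h4
    rw [h1, h3, h4, Pi.smul_apply, Pi.smul_apply, h2, smul_eq_mul, smul_eq_mul, map_mul]

theorem sub_smulRight_eq [CompleteSpace B] (hB : IsBanachFunctionSpace m ι)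
    (hℓ : ∀ b, ℓ b = ∫ x, ι b x ∂m) (hone : ∀ᵐ x ∂m, ι one x = 1) {L N : B →L[ℂ] B}
    (hN : ∀ b, ∀ᵐ x ∂m, ι (L b) x = (∫ z, ι b z ∂m) + ι (N b) x) :
    L - ℓ.smulRight one = N := by
  ext b
  refine hB.ext_ae ?_
  rw [sub_apply, ContinuousLinearMap.smulRight_apply, map_sub, map_smul]
  filter_upwards [hN b, hone, Lp.coeFn_sub (ι (L b)) (ℓ b • ι one),
    Lp.coeFn_smul (ℓ b) (ι one)] with x h1 h2 h3 h4
  rw [h3, Pi.sub_apply, h4, Pi.smul_apply, h1, h2, hℓ]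
  simp

variable [IsProbabilityMeasure m]

theorem Lp_top_integrable (g : Lp ℂ ∞ m) : Integrable g m :=
  (Lp.memLp g).integrable le_top

theorem Lp_top_norm_integral_le (g : Lp ℂ ∞ m) : ‖∫ x, g x ∂m‖ ≤ ‖g‖ := by
  have hfin : eLpNormEssSup g m ≠ ∞ := by
    have := (Lp.memLp g).2.ne
    rwa [eLpNorm_exponent_top] at this
  have hbd : ∀ᵐ x ∂m, ‖g x‖ ≤ ‖g‖ := by
    filter_upwards [enorm_ae_le_eLpNormEssSup g m] with x h
    rw [Lp.norm_def, eLpNorm_exponent_top, ← toReal_enorm]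
    exact ENNReal.toReal_mono hfin h
  simpa using norm_integral_le_of_norm_le_const hbd

theorem integrable_exp_mul (hφ : Measurable φ) (t : ℝ) (g : Lp ℂ ∞ m) :
    Integrable (fun x => Complex.exp (Complex.I * t * φ x) * g x) m :=
  (Lp_top_integrable g).bdd_mul (c := 1) (by fun_prop)
    (Eventually.of_forall fun x => (norm_exp_I_mul_mul _ _).le)

/-- The characteristic function of the Birkhoff sums in terms of the operators `P(t)`. -/
theorem apply_pow_eq_integral_exp_birkhoffSum (hT : MeasurePreserving T m m) (hφ : Measurable φ)
    (hℓ : ∀ b, ℓ b = ∫ x, ι b x ∂m)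
    (hP : ∀ (t : ℝ) (b : B), ι (P t b) =ᵐ[m] charOp m T φ t (ι b)) (t : ℝ) (n : ℕ) (b : B) :
    ℓ ((P t ^ n) b) = ∫ x, Complex.exp (Complex.I * t * birkhoffSum T φ n x) * ι b x ∂m := by
  induction n generalizing b with
  | zero => simp [hℓ]
  | succ n ih =>
    rw [pow_succ, mul_apply_eq_comp, ih]
    have hS := measurable_birkhoffSum hT.measurable hφ n
    have hg : MemLp (fun x => Complex.exp (Complex.I * t * birkhoffSum T φ n x)) ∞ m :=
      memLp_top_of_bound (by fun_prop) 1
        (Eventually.of_forall fun x => (norm_exp_I_mul_mul _ _).le)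
    -- Duality applies because `S_{n+1} = φ + S_n ∘ T`: the innermost `P(t)` absorbs the first
    -- summand and one composition with `T`.
    have h2 := integral_mul_comp_eq_integral_transferOp_mul hT
      (integrable_exp_mul hφ t (ι b)) hg
    have h3 : ∫ x, Complex.exp (Complex.I * t * birkhoffSum T φ n x) * ι (P t b) x ∂m =
        ∫ x, transferOp m T (fun x => Complex.exp (Complex.I * t * φ x) * ι b x) x *
          Complex.exp (Complex.I * t * birkhoffSum T φ n x) ∂m := by
      refine integral_congr_ae ?_
      filter_upwards [hP t b] with x hx
      rw [hx, mul_comm]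
      rfl
    rw [h3, ← h2]
    refine integral_congr_ae (Eventually.of_forall fun x => ?_)
    simp only [birkhoffSum_succ']
    push_cast
    rw [mul_add, Complex.exp_add]
    ring

theorem apply_pow_one_eq_integral_exp_birkhoffSum (hT : MeasurePreserving T m m)
    (hφ : Measurable φ) (hℓ : ∀ b, ℓ b = ∫ x, ι b x ∂m) (hone : ∀ᵐ x ∂m, ι one x = 1)
    (hP : ∀ (t : ℝ) (b : B), ι (P t b) =ᵐ[m] charOp m T φ t (ι b)) (t : ℝ) (n : ℕ) :
    ℓ ((P t ^ n) one) = ∫ x, Complex.exp (Complex.I * t * birkhoffSum T φ n x) ∂m := by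
  rw [apply_pow_eq_integral_exp_birkhoffSum hT hφ hℓ hP]
  refine integral_congr_ae ?_
  filter_upwards [hone] with x hx
  rw [hx, mul_one]

variable [CompleteSpace B]

theorem IsBanachFunctionSpace.exists_integral (hB : IsBanachFunctionSpace m ι) :
    ∃ ℓ : B →L[ℂ] ℂ, ∀ b, ℓ b = ∫ x, ι b x ∂m := by
  obtain ⟨C, hC, hle⟩ := hB.norm_le
  refine ⟨LinearMap.mkContinuous
    { toFun := fun b => ∫ x, ι b x ∂m
      map_add' := fun a b => ?_
      map_smul' := fun c b => ?_ } C fun b => (Lp_top_norm_integral_le _).trans (hle b),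
    fun b => rfl⟩
  · rw [map_add, integral_congr_ae (Lp.coeFn_add _ _)]
    exact integral_add (Lp_top_integrable _) (Lp_top_integrable _)
  · rw [map_smul, integral_congr_ae (Lp.coeFn_smul _ _)]
    exact integral_const_mul c _

theorem charOp_perturbation_eq (hT : MeasurePreserving T m m) (hB : IsBanachFunctionSpace m ι)
    (hℓ : ∀ b, ℓ b = ∫ x, ι b x ∂m) (hone : ∀ᵐ x ∂m, ι one x = 1)
    (hP : ∀ (t : ℝ) (b : B), ι (P t b) =ᵐ[m] charOp m T φ t (ι b)) :
    ℓ one = 1 ∧ P 0 one = one ∧ ∀ b, ℓ (P 0 b) = ℓ b := by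
  refine ⟨?_, ?_, fun b => ?_⟩
  · rw [hℓ, integral_congr_ae hone]; simp
  · refine hB.ext_ae ?_
    have h1 := hP 0 one
    rw [charOp_zero, transferOp_congr_ae hone] at h1
    filter_upwards [h1, transferOp_one hT, hone] with x h1 h2 h3
    rw [h1, h2, h3]
  · have h1 := hP 0 b
    rw [charOp_zero] at h1
    rw [hℓ, hℓ, integral_congr_ae h1, integral_transferOp hT (Lp_top_integrable _)]

/-- The second order coefficient of the leading eigenvalue is real. -/
theorem second_order_coefficient_im_eq_zero (hT : MeasurePreserving T m m) (hφ : Integrable φ m)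
    (hB : IsBanachFunctionSpace m ι)
    (hℓ : ∀ b, ℓ b = ∫ x, ι b x ∂m) (hone : ∀ᵐ x ∂m, ι one x = 1)
    (hP : ∀ b : B, ι (P 0 b) =ᵐ[m] transferOp m T (ι b))
    (hu : IsUnit (1 - (P 0 - ℓ.smulRight one))) {P' : B →L[ℂ] B}
    (hP' : ∀ b : B, ι (P' b) =ᵐ[m] transferOp m T fun x => Complex.I * φ x * ι b x) :
    (ℓ (P' (Ring.inverse (1 - (P 0 - ℓ.smulRight one)) (P' one)))).im = 0 := by
  obtain ⟨J, hJ⟩ := hB.exists_conj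
  have hint : ∀ g : Lp ℂ ∞ m, Integrable (fun x => Complex.I * φ x * g x) m := fun g => by
    have h1 : Integrable (fun x => Complex.I * (φ x : ℂ)) m := hφ.ofReal.const_mul _
    exact h1.mul_of_top_left (Lp.memLp g)
  have J1 : J one = one := by
    refine hB.ext_ae ?_
    filter_upwards [hJ one, hone] with x h1 h2
    rw [h1, h2, map_one]
  have JP : ∀ b, J (P 0 b) = P 0 (J b) := fun b => by
    refine hB.ext_ae ?_
    have h1 := hP (J b)
    rw [transferOp_congr_ae (hJ b)] at h1
    filter_upwards [hJ (P 0 b), hP b, h1, transferOp_conj hT (Lp_top_integrable (ι b))]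
      with x h1 h2 h3 h4
    rw [h1, h2, h3, h4]
  have Jl : ∀ b, ℓ (J b) = conj (ℓ b) := fun b => by
    rw [hℓ, hℓ, integral_congr_ae (hJ b), integral_conj]
  -- `T̂` commutes with conjugation and `iφ` is purely imaginary.
  have Ju : J (P' one) = -P' one := by
    refine hB.ext_ae ?_
    rw [map_neg]
    have e1 : (fun x => Complex.I * φ x * ι one x) =ᵐ[m] fun x => Complex.I * φ x := by
      filter_upwards [hone] with x hx
      rw [hx, mul_one]
    have h1 := hP' one
    rw [transferOp_congr_ae e1] at h1
    have hi : Integrable (fun x => Complex.I * (φ x : ℂ)) m := hφ.ofReal.const_mul _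
    have h2 := transferOp_conj hT hi
    have e2 : (fun x => conj (Complex.I * (φ x : ℂ))) = fun x => -(Complex.I * (φ x : ℂ)) := by
      ext x; simp
    rw [e2] at h2
    filter_upwards [hJ (P' one), h1, h2, transferOp_neg hT hi, Lp.coeFn_neg (ι (P' one))]
      with x h1 h2 h3 h4 h5
    rw [h1, h5, Pi.neg_apply, h2, ← h3, h4]
  set w := Ring.inverse (1 - (P 0 - ℓ.smulRight one)) (P' one) with hw
  have hw1 : w - (P 0 w - ℓ w • one) = P' one := by
    have := congrArg (fun S : B →L[ℂ] B => S (P' one)) (Ring.mul_inverse_cancel _ hu)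
    simpa using this
  have hw2 : J w - (P 0 (J w) - ℓ (J w) • one) = -P' one := by
    have := congrArg J hw1
    simpa [JP, J1, Ju, Jl] using this
  have hw3 : (1 - (P 0 - ℓ.smulRight one)) (J w + w) = 0 := by
    have : (1 - (P 0 - ℓ.smulRight one)) (J w + w) =
        (J w - (P 0 (J w) - ℓ (J w) • one)) + (w - (P 0 w - ℓ w • one)) := by
      simp only [sub_apply, one_apply_eq_self, map_add, ContinuousLinearMap.smulRight_apply]
    rw [this, hw1, hw2, neg_add_cancel]
  -- `J w + w` solves the homogeneous resolvent equation, so it vanishes. Only the equation is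
  -- conjugated; continuity of `J` plays no role. Thus `w` is purely imaginary and `iφw` is real.
  have hw4 : J w = -w := by
    have := congrArg (fun S : B →L[ℂ] B => S (J w + w)) (Ring.inverse_mul_cancel _ hu)
    simp only [mul_apply_eq_comp, hw3, map_zero, one_apply_eq_self] at this
    exact eq_neg_of_add_eq_zero_left this.symm
  have hlw : ℓ (P' w) = ∫ x, Complex.I * φ x * ι w x ∂m := by
    rw [hℓ, integral_congr_ae (hP' w), integral_transferOp hT (hint _)]
  have hconj : conj (ℓ (P' w)) = ℓ (P' w) := by
    rw [hlw, ← integral_conj]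
    refine integral_congr_ae ?_
    have h1 := hJ w
    rw [hw4, map_neg] at h1
    filter_upwards [h1, Lp.coeFn_neg (ι w)] with x h1 h2
    rw [map_mul, ← h1, h2]
    simp
  exact Complex.conj_eq_iff_im.1 hconj

end FunctionSpace

/-! ### Characteristic functions of real observables -/

section CharacteristicFunction

variable {X : Type*} [MeasurableSpace X] {m : Measure X} [IsProbabilityMeasure m]

theorem integral_exp_isLittleO {φ : X → ℝ} (hφ2 : MemLp φ 2 m) (hφ0 : ∫ x, φ x ∂m = 0) :
    (fun t : ℝ => ∫ x, Complex.exp (Complex.I * t * φ x) ∂m -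
      (1 - (((∫ x, φ x ^ 2 ∂m) / 2 : ℝ) : ℂ) * t ^ 2)) =o[𝓝 0] fun t : ℝ => t ^ 2 := by
  have hm : AEMeasurable φ m := hφ2.1.aemeasurable
  have : IsProbabilityMeasure (m.map φ) := Measure.isProbabilityMeasure_map hm
  have h2 : MemLp id 2 (m.map φ) := (memLp_map_measure_iff (by fun_prop) hm).2 hφ2
  have h3 := taylor_isLittleO_univ (x₀ := 0) (contDiff_charFun (n := 2) h2)
  simp only [taylorWithinEval_charFun_two_zero hm h2, hφ0, sub_zero] at h3
  refine h3.congr_left fun t => ?_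
  rw [charFun_apply_real, integral_map hm (by fun_prop)]
  congr 1
  · refine integral_congr_ae (Eventually.of_forall fun x => ?_)
    simp only
    congr 1
    ring
  · simp only [Pi.pow_apply]
    push_cast
    ring

theorem integral_exp_re {S : X → ℝ} (hS : Measurable S) (t : ℝ) :
    (∫ x, Complex.exp (Complex.I * t * S x) ∂m).re = ∫ x, Real.cos (t * S x) ∂m := by
  have h := integral_re (𝕜 := ℂ) (integrable_exp_I_mul (m := m) hS t)
  rw [← RCLike.re_eq_complex_re, ← h]
  refine integral_congr_ae (Eventually.of_forall fun x => ?_)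
  have : Complex.I * t * S x = ((t * S x : ℝ) : ℂ) * Complex.I := by push_cast; ring
  simp only [this, RCLike.re_eq_complex_re, Complex.exp_ofReal_mul_I_re]

theorem integral_exp_im {S : X → ℝ} (hS : Measurable S) (t : ℝ) :
    (∫ x, Complex.exp (Complex.I * t * S x) ∂m).im = ∫ x, Real.sin (t * S x) ∂m := by
  have h := integral_im (𝕜 := ℂ) (integrable_exp_I_mul (m := m) hS t)
  rw [← RCLike.im_eq_complex_im, ← h]
  refine integral_congr_ae (Eventually.of_forall fun x => ?_)
  have : Complex.I * t * S x = ((t * S x : ℝ) : ℂ) * Complex.I := by push_cast; ring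
  simp only [this, RCLike.im_eq_complex_im, Complex.exp_ofReal_mul_I_im]

/-- Pointwise, `1 - cos 2u = 2 (1 - cos u)(1 + cos u) ≤ 4 (1 - cos u)`. -/
theorem one_sub_re_integral_exp_two_mul_le {S : X → ℝ} (hS : Measurable S) (t : ℝ) :
    1 - (∫ x, Complex.exp (Complex.I * (2 * t : ℝ) * S x) ∂m).re ≤
      4 * (1 - (∫ x, Complex.exp (Complex.I * t * S x) ∂m).re) := by
  rw [integral_exp_re hS, integral_exp_re hS]
  have hi : ∀ u : ℝ, Integrable (fun x => Real.cos (u * S x)) m := fun u =>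
    Integrable.of_bound (by fun_prop) 1 (Eventually.of_forall fun x => Real.abs_cos_le_one _)
  have h1 : ∀ u : ℝ, 1 - ∫ x, Real.cos (u * S x) ∂m = ∫ x, (1 - Real.cos (u * S x)) ∂m :=
    fun u => by rw [integral_sub (integrable_const _) (hi u)]; simp
  rw [h1, h1, ← integral_const_mul]
  refine integral_mono ((integrable_const _).sub (hi _))
    (((integrable_const _).sub (hi _)).const_mul _) fun x => ?_
  have h2 := Real.cos_two_mul (t * S x)
  rw [← mul_assoc] at h2
  simp only [h2]
  nlinarith [sq_nonneg (1 - Real.cos (t * S x))]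

end CharacteristicFunction

/-! ### Integrable kernels -/

section Kernels

/-- Keeps both the quadratic vanishing at `0` and boundedness at infinity; with `u = t y` and a
weight `t⁻²` the bound is integrable over the whole line. -/
theorem Real.one_sub_cos_le_div (u : ℝ) : 1 - Real.cos u ≤ 4 * u ^ 2 * (1 + u ^ 2)⁻¹ := by
  have h1 : 1 - u ^ 2 / 2 ≤ Real.cos u := Real.one_sub_sq_div_two_le_cos
  have h2 := Real.neg_one_le_cos u
  rw [← div_eq_mul_inv, le_div_iff₀ (by positivity)]
  rcases le_total (u ^ 2) 1 with h | h
  · nlinarith [sq_nonneg u, mul_nonneg (sq_nonneg u) (sub_nonneg.2 h)]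
  · nlinarith

theorem Real.abs_sin_sub_self_le (u : ℝ) : |Real.sin u - u| ≤ 4 * |u| ^ 3 * (1 + u ^ 2)⁻¹ := by
  wlog hu : 0 ≤ u generalizing u
  · have := this (-u) (by linarith)
    rw [Real.sin_neg, abs_neg, neg_sq, ← neg_add', abs_neg] at this
    exact this
  rcases hu.eq_or_lt with rfl | hu
  · simp
  have h1 : |Real.sin u - u| ≤ u ^ 3 / 6 := by
    rw [abs_sub_comm, abs_of_nonneg (by linarith [Real.sin_le hu.le])]
    linarith [Real.sin_gt_sub_cube hu]
  have h2 : |Real.sin u - u| ≤ 2 * u := by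
    have := Real.abs_sin_le_abs (x := u)
    rw [abs_of_pos hu] at this
    refine (abs_sub _ _).trans ?_
    rw [abs_of_pos hu]
    linarith
  rw [abs_of_pos hu, ← div_eq_mul_inv, le_div_iff₀ (by positivity)]
  rcases le_total u 1 with h | h
  · have h3 : u ^ 2 ≤ 1 := pow_le_one₀ hu.le h
    have h4 : 0 < u ^ 3 := by positivity
    calc |Real.sin u - u| * (1 + u ^ 2) ≤ u ^ 3 / 6 * (1 + 1) := by gcongr
      _ ≤ _ := by linarith
  · have h3 : 1 ≤ u ^ 2 := one_le_pow₀ h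
    calc |Real.sin u - u| * (1 + u ^ 2) ≤ 2 * u * (u ^ 2 + u ^ 2) := by gcongr
      _ = _ := by ring

/-- Scaling `t ↦ t a` turns `a²` into `|a|`. This yields both the linear bound in `|y|` and the
reduction from three moments of `φ` to two. -/
theorem integral_sq_mul_inv_one_add_sq (a : ℝ) :
    Integrable (fun t : ℝ => a ^ 2 * (1 + (t * a) ^ 2)⁻¹) ∧
      ∫ t : ℝ, a ^ 2 * (1 + (t * a) ^ 2)⁻¹ = Real.pi * |a| := by
  rcases eq_or_ne a 0 with rfl | ha
  · simp
  · refine ⟨(integrable_inv_one_add_sq.comp_mul_right' ha).const_mul _, ?_⟩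
    rw [integral_const_mul, Measure.integral_comp_mul_right (fun t : ℝ => (1 + t ^ 2)⁻¹) a,
      integral_univ_inv_one_add_sq, smul_eq_mul, abs_inv, ← sq_abs]
    have : |a| ≠ 0 := abs_ne_zero.2 ha
    field_simp

variable {X : Type*} [MeasurableSpace X] {m : Measure X} [IsProbabilityMeasure m]

/-- By Tonelli, the integral in `t` taken first equals `4π φ²`, so the second moment suffices. -/
theorem integrable_cube_kernel {φ : X → ℝ} (hφ : Measurable φ) (hφ2 : MemLp φ 2 m) :
    Integrable (fun t : ℝ => ∫ x, 4 * |φ x| ^ 3 * (1 + (t * φ x) ^ 2)⁻¹ ∂m) := by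
  refine Integrable.integral_prod_left
    (f := fun p : ℝ × X => 4 * |φ p.2| ^ 3 * (1 + (p.1 * φ p.2) ^ 2)⁻¹) ?_
  have e : ∀ (t : ℝ) (x : X), 4 * |φ x| ^ 3 * (1 + (t * φ x) ^ 2)⁻¹ =
      4 * |φ x| * (φ x ^ 2 * (1 + (t * φ x) ^ 2)⁻¹) := fun t x => by
    rw [← sq_abs (φ x)]; ring
  have hmeas : Measurable fun p : ℝ × X => 4 * |φ p.2| ^ 3 * (1 + (p.1 * φ p.2) ^ 2)⁻¹ := by
    have h1 : Measurable fun p : ℝ × X => φ p.2 := hφ.comp measurable_snd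
    have h2 : Measurable fun p : ℝ × X => |φ p.2| := by
      simpa [Real.norm_eq_abs] using h1.norm
    exact ((h2.pow_const 3).const_mul 4).mul
      ((((measurable_fst.mul h1).pow_const 2).const_add 1).inv)
  rw [integrable_prod_iff' hmeas.aestronglyMeasurable]
  refine ⟨Eventually.of_forall fun x => ?_, ?_⟩
  · simp only [e]
    exact (integral_sq_mul_inv_one_add_sq (φ x)).1.const_mul _
  · have e2 : (fun x => ∫ t : ℝ, ‖4 * |φ x| ^ 3 * (1 + (t * φ x) ^ 2)⁻¹‖) =
        fun x => 4 * Real.pi * φ x ^ 2 := by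
      ext x
      have : ∀ t : ℝ, ‖4 * |φ x| ^ 3 * (1 + (t * φ x) ^ 2)⁻¹‖ =
          4 * |φ x| * (φ x ^ 2 * (1 + (t * φ x) ^ 2)⁻¹) := fun t => by
        rw [Real.norm_of_nonneg (by positivity), e]
      simp only [this]
      rw [integral_const_mul, (integral_sq_mul_inv_one_add_sq (φ x)).2, ← sq_abs]
      ring
    simp only [e2]
    exact hφ2.integrable_sq.const_mul _

/-- Mean zero allows `sin (tφ)` to be replaced by `sin (tφ) - tφ`, which vanishes to third order. -/
theorem abs_integral_sin_le {φ : X → ℝ} (hφ : Measurable φ) (hφ1 : Integrable φ m)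
    (hφ0 : ∫ x, φ x ∂m = 0) {t : ℝ} (ht : t ≠ 0) :
    |∫ x, Real.sin (t * φ x) ∂m| ≤
      |t| ^ 3 * ∫ x, 4 * |φ x| ^ 3 * (1 + (t * φ x) ^ 2)⁻¹ ∂m := by
  have hs : Integrable (fun x => Real.sin (t * φ x)) m :=
    Integrable.of_bound (by fun_prop) 1 (Eventually.of_forall fun x => Real.abs_sin_le_one _)
  have e1 : ∫ x, Real.sin (t * φ x) ∂m = ∫ x, (Real.sin (t * φ x) - t * φ x) ∂m := by
    rw [integral_sub hs (hφ1.const_mul t), integral_const_mul, hφ0, mul_zero, sub_zero]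
  rw [e1, ← integral_const_mul]
  have hmeas : Measurable fun x => |φ x| := by simpa [Real.norm_eq_abs] using hφ.norm
  have hint : Integrable (fun x => |t| ^ 3 * (4 * |φ x| ^ 3 * (1 + (t * φ x) ^ 2)⁻¹)) m := by
    have hi : Integrable (fun x => |t| * 4 * |φ x|) m := hφ1.abs.const_mul _
    refine hi.mono ?_ (Eventually.of_forall fun x => ?_)
    · exact (((hmeas.pow_const 3).const_mul 4).mul
        ((((hφ.const_mul t).pow_const 2).const_add 1).inv)).const_mul _ |>.aestronglyMeasurable
    · rw [Real.norm_of_nonneg (by positivity), Real.norm_of_nonneg (by positivity),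
        ← sq_abs (t * φ x), abs_mul]
      have h0 : 0 ≤ |t| * 4 * |φ x| := by positivity
      have h1 : (|t| * |φ x|) ^ 2 * (1 + (|t| * |φ x|) ^ 2)⁻¹ ≤ 1 := by
        rw [← div_eq_mul_inv, div_le_one (by positivity)]; linarith
      calc |t| ^ 3 * (4 * |φ x| ^ 3 * (1 + (|t| * |φ x|) ^ 2)⁻¹)
          = |t| * 4 * |φ x| * ((|t| * |φ x|) ^ 2 * (1 + (|t| * |φ x|) ^ 2)⁻¹) := by ring
        _ ≤ |t| * 4 * |φ x| * 1 := by gcongr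
        _ = _ := mul_one _
  rw [← Real.norm_eq_abs]
  refine norm_integral_le_of_norm_le hint (Eventually.of_forall fun x => ?_)
  rw [Real.norm_eq_abs]
  refine (Real.abs_sin_sub_self_le (t * φ x)).trans_eq ?_
  rw [abs_mul]; ring

end Kernels

/-! ### Fourier representation of the test function -/

section FourierInversion

theorem fourier_im_eq_zero_of_even {f : ℝ → ℝ} (hf_symm : ∀ x, f (-x) = f x) (ξ : ℝ) :
    (𝓕 (fun x : ℝ => (f x : ℂ)) ξ).im = 0 := by
  refine Complex.conj_eq_iff_im.1 ?_
  rw [Real.fourier_real_eq_integral_exp_smul, ← integral_conj, ← integral_neg_eq_self]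
  refine integral_congr_ae (Eventually.of_forall fun v => ?_)
  simp only [smul_eq_mul, map_mul, hf_symm, Complex.conj_ofReal, ← Complex.exp_conj,
    Complex.conj_I]
  congr 2
  push_cast
  ring

/-- An even integrable function whose Fourier transform has compact support is a superposition of
cosines of bounded frequency. -/
theorem exists_cosine_representation {f : ℝ → ℝ} (hf : Continuous f) (hf_int : Integrable f)
    (hf_symm : ∀ x, f (-x) = f x) (hf_supp : HasCompactSupport (𝓕 (fun x : ℝ => (f x : ℂ)))) :
    ∃ h : ℝ → ℝ, Continuous h ∧ HasCompactSupport h ∧ ∀ x, f x = ∫ t, h t * Real.cos (t * x) := by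
  set F : ℝ → ℂ := fun x => (f x : ℂ) with hF
  have hFc : Continuous F := Complex.continuous_ofReal.comp hf
  have hFi : Integrable F := hf_int.ofReal
  have hgc : Continuous (𝓕 F) :=
    VectorFourier.fourierIntegral_continuous Real.continuous_fourierChar
      (by fun_prop : Continuous fun p : ℝ × ℝ => (innerₗ ℝ p.1) p.2) hFi
  have hgi : Integrable (𝓕 F) := hgc.integrable_of_hasCompactSupport hf_supp
  have hpi : (2 * Real.pi)⁻¹ ≠ 0 := by positivity
  -- Substituting `t = 2πξ` in the inversion formula. The real part loses nothing, since evenness of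
  -- `f` makes its transform real.
  refine ⟨fun t => (𝓕 F (t * (2 * Real.pi)⁻¹)).re * (2 * Real.pi)⁻¹, ?_, ?_, fun x => ?_⟩
  · exact (Complex.continuous_re.comp (hgc.comp (continuous_mul_const _))).mul_const _
  · have h1 : HasCompactSupport ((𝓕 F) ∘ (Homeomorph.mulRight₀ (2 * Real.pi)⁻¹ hpi)) :=
      hf_supp.comp_homeomorph _
    exact h1.comp_left (g := fun z : ℂ => z.re * (2 * Real.pi)⁻¹) (by simp)
  · have h1 := congrFun (hFc.fourierInv_fourier_eq hFi hgi) x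
    rw [Real.fourierInv_eq'] at h1
    have hi : Integrable fun ξ : ℝ =>
        Complex.exp (((2 * Real.pi * inner ℝ ξ x : ℝ) : ℂ) * Complex.I) • 𝓕 F ξ := by
      refine hgi.bdd_mul (c := 1) ?_ (Eventually.of_forall fun ξ => ?_)
      · exact (by fun_prop : Continuous fun ξ : ℝ =>
          Complex.exp (((2 * Real.pi * inner ℝ ξ x : ℝ) : ℂ) * Complex.I)).aestronglyMeasurable
      · rw [Complex.norm_exp_ofReal_mul_I]
    have h2 := congrArg Complex.re h1
    have h3 := integral_re (𝕜 := ℂ) hi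
    simp only [RCLike.re_eq_complex_re] at h3
    rw [← h3] at h2
    have h4 : (F x).re = f x := by simp [hF]
    rw [h4] at h2
    rw [← h2]
    have h5 := Measure.integral_comp_mul_right
      (fun ξ : ℝ => (𝓕 F ξ).re * (2 * Real.pi)⁻¹ * Real.cos (2 * Real.pi * ξ * x))
      (2 * Real.pi)⁻¹
    have h6 : ∀ t : ℝ, 2 * Real.pi * (t * (2 * Real.pi)⁻¹) * x = t * x := fun t => by
      field_simp
    simp only [h6] at h5
    rw [h5, inv_inv, abs_of_pos (by positivity : 0 < 2 * Real.pi), smul_eq_mul,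
      ← integral_const_mul]
    refine integral_congr_ae (Eventually.of_forall fun ξ => ?_)
    simp only [smul_eq_mul, Complex.mul_re, fourier_im_eq_zero_of_even hf_symm ξ, mul_zero,
      sub_zero, Complex.exp_ofReal_mul_I_re, hF]
    have h7 : inner ℝ ξ x = ξ * x := by simp [mul_comm]
    rw [h7, ← mul_assoc]
    field_simp

variable {X : Type*} [MeasurableSpace X] {m : Measure X} [IsProbabilityMeasure m]

/-- Fubini and the addition formula for `cos (tS + ty)`: the real part of the characteristic
function is paired with `1 - cos ty`, the imaginary part with `sin ty`. -/
theorem integral_sub_shift_eq {f h : ℝ → ℝ} (hh : Continuous h) (hhs : HasCompactSupport h)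
    (hfh : ∀ x, f x = ∫ t, h t * Real.cos (t * x)) {S : X → ℝ} (hS : Measurable S) (y : ℝ) :
    ∫ x, (f (S x) - f (S x + y)) ∂m =
      ∫ t, h t * ((1 - Real.cos (t * y)) * ∫ x, Real.cos (t * S x) ∂m +
        Real.sin (t * y) * ∫ x, Real.sin (t * S x) ∂m) := by
  have hhi : Integrable h := hh.integrable_of_hasCompactSupport hhs
  have hci : ∀ x : ℝ, Integrable fun t => h t * Real.cos (t * x) := fun x =>
    hhi.mul_bdd (c := 1) (by fun_prop) (Eventually.of_forall fun t => Real.abs_cos_le_one _)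
  have e1 : ∀ x, f (S x) - f (S x + y) =
      ∫ t, h t * (Real.cos (t * S x) - Real.cos (t * (S x + y))) := fun x => by
    rw [hfh, hfh, ← integral_sub (hci _) (hci _)]
    simp only [mul_sub]
  simp only [e1]
  rw [integral_integral_swap]
  · refine integral_congr_ae (Eventually.of_forall fun t => ?_)
    have i1 : Integrable (fun x => Real.cos (t * S x)) m :=
      Integrable.of_bound (by fun_prop) 1 (Eventually.of_forall fun x => Real.abs_cos_le_one _)
    have i2 : Integrable (fun x => Real.sin (t * S x)) m :=
      Integrable.of_bound (by fun_prop) 1 (Eventually.of_forall fun x => Real.abs_sin_le_one _)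
    simp only
    rw [integral_const_mul, ← integral_const_mul (1 - Real.cos (t * y)),
      ← integral_const_mul (Real.sin (t * y)), ← integral_add (i1.const_mul _) (i2.const_mul _)]
    congr 1
    refine integral_congr_ae (Eventually.of_forall fun x => ?_)
    simp only [mul_add, Real.cos_add]
    ring
  · have h1 : Integrable (fun p : X × ℝ => h p.2) (m.prod volume) := hhi.comp_snd m
    refine h1.mul_bdd (c := 2) ?_ (Eventually.of_forall fun p => ?_)
    · have hS' : Measurable fun p : X × ℝ => S p.1 := hS.comp measurable_fst
      exact (by fun_prop : Measurable fun p : X × ℝ =>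
        Real.cos (p.2 * S p.1) - Real.cos (p.2 * (S p.1 + y))).aestronglyMeasurable
    · refine (norm_sub_le _ _).trans ?_
      have a1 := Real.abs_cos_le_one (p.2 * S p.1)
      have a2 := Real.abs_cos_le_one (p.2 * (S p.1 + y))
      rw [Real.norm_eq_abs, Real.norm_eq_abs]
      linarith

theorem continuous_integral_cos {S : X → ℝ} (hS : Measurable S) :
    Continuous fun t : ℝ => ∫ x, Real.cos (t * S x) ∂m :=
  continuous_of_dominated (bound := fun _ => 1) (fun t => by fun_prop)
    (fun t => Eventually.of_forall fun x => Real.abs_cos_le_one _) (integrable_const _)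
    (Eventually.of_forall fun x => by fun_prop)

theorem continuous_integral_sin {S : X → ℝ} (hS : Measurable S) :
    Continuous fun t : ℝ => ∫ x, Real.sin (t * S x) ∂m :=
  continuous_of_dominated (bound := fun _ => 1) (fun t => by fun_prop)
    (fun t => Eventually.of_forall fun x => Real.abs_sin_le_one _) (integrable_const _)
    (Eventually.of_forall fun x => by fun_prop)

end FourierInversion

/-! ### Summation of the oscillatory integrals -/

section Potential

theorem Real.one_sub_cos_le_abs (u : ℝ) : 1 - Real.cos u ≤ |u| := by
  have h1 := Real.one_sub_sq_div_two_le_cos (x := u)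
  have h2 := Real.neg_one_le_cos u
  have h3 := sq_abs u
  rcases le_total |u| 2 with h | h
  · nlinarith [abs_nonneg u]
  · linarith

variable {X : Type*} [MeasurableSpace X] {m : Measure X} [IsProbabilityMeasure m]

/-- Summation of the oscillatory integrals that represent the potential kernel. -/
theorem exists_sum_abs_integral_le {S : ℕ → X → ℝ} (hS : ∀ j, Measurable (S j)) {φ : X → ℝ}
    (hφ : Measurable φ) (hφ2 : MemLp φ 2 m) (hφ0 : ∫ x, φ x ∂m = 0) {h : ℝ → ℝ}
    (hh : Continuous h) (hhs : HasCompactSupport h) {δ K : ℝ} (hK : 0 ≤ K)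
    (near : ∀ t : ℝ, t ≠ 0 → |t| < δ → ∀ n,
      t ^ 2 * ∑ j ∈ Finset.range n, |∫ x, Real.cos (t * S j x) ∂m| ≤ K ∧
      |t| * ∑ j ∈ Finset.range n, |∫ x, Real.sin (t * S j x) ∂m| ≤
        K * (|∫ x, Real.sin (t * φ x) ∂m| / |t| ^ 3 + 1))
    (far : ∀ R : ℝ, ∃ K' : ℝ, ∀ t : ℝ, δ ≤ |t| → |t| ≤ R → ∀ n, ∑ j ∈ Finset.range n,
      (|∫ x, Real.cos (t * S j x) ∂m| + |∫ x, Real.sin (t * S j x) ∂m|) ≤ K') :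
    ∃ C : ℝ, 0 < C ∧ ∀ (y : ℝ) (n : ℕ), ∑ j ∈ Finset.range n,
      |∫ t, h t * ((1 - Real.cos (t * y)) * ∫ x, Real.cos (t * S j x) ∂m +
        Real.sin (t * y) * ∫ x, Real.sin (t * S j x) ∂m)| ≤ C * |y| := by
  obtain ⟨H, hH⟩ := hh.bounded_above_of_compact_support hhs
  have hH0 : 0 ≤ H := (norm_nonneg _).trans (hH 0)
  obtain ⟨R₀, hR₀⟩ := hhs.isCompact.isBounded.subset_closedBall (0 : ℝ)
  set R : ℝ := max R₀ 0 with hR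
  have hRn : 0 ≤ R := le_max_right _ _
  have hsupp : ∀ t, R < |t| → h t = 0 := fun t ht => by
    by_contra hne
    have h1 := hR₀ (subset_tsupport h hne)
    rw [mem_closedBall_zero_iff, Real.norm_eq_abs] at h1
    exact absurd (h1.trans (le_max_left _ _)) (not_le.2 ht)
  obtain ⟨K₀, hK₀⟩ := far R
  set K' : ℝ := max K₀ 0 with hK'
  have hK'0 : 0 ≤ K' := le_max_right _ _
  set J : ℝ → ℝ := fun t => ∫ x, 4 * |φ x| ^ 3 * (1 + (t * φ x) ^ 2)⁻¹ ∂m with hJ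
  have hJi : Integrable J := integrable_cube_kernel hφ hφ2
  have hJ0 : ∀ t, 0 ≤ J t := fun t => integral_nonneg fun x => by positivity
  have hφ1 : Integrable φ m := hφ2.integrable (by norm_num)
  set c : ℕ → ℝ → ℝ := fun j t => ∫ x, Real.cos (t * S j x) ∂m with hc
  set s : ℕ → ℝ → ℝ := fun j t => ∫ x, Real.sin (t * S j x) ∂m with hs
  have hcc : ∀ j, Continuous (c j) := fun j => continuous_integral_cos (hS j)
  have hsc : ∀ j, Continuous (s j) := fun j => continuous_integral_sin (hS j)
  set G : ℝ := H * (K + R * K') with hG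
  have hG0 : 0 ≤ G := by positivity
  -- A majorant independent of the number of terms: the cosine part near `0`, the part of the sine
  -- sum governed by `m(sin tφ)`, and a constant on the support of `h` for all that is bounded by a
  -- multiple of `|y|`.
  set W : ℝ → ℝ → ℝ := fun y t => 4 * H * K * (y ^ 2 * (1 + (t * y) ^ 2)⁻¹) +
    |y| * (H * K * J t + (Icc (-R) R).indicator (fun _ => G) t) with hW
  have hIi : Integrable ((Icc (-R) R).indicator fun _ : ℝ => G) :=
    (integrable_indicator_iff measurableSet_Icc).2 (integrableOn_const (by simp))
  have hW1 : ∀ y, Integrable fun t => 4 * H * K * (y ^ 2 * (1 + (t * y) ^ 2)⁻¹) := fun y =>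
    (integral_sq_mul_inv_one_add_sq y).1.const_mul _
  have hW2 : ∀ y : ℝ, Integrable fun t =>
      |y| * (H * K * J t + (Icc (-R) R).indicator (fun _ => G) t) := fun y =>
    ((hJi.const_mul (H * K)).add hIi).const_mul _
  have hWi : ∀ y, Integrable (W y) := fun y => (hW1 y).add (hW2 y)
  set C : ℝ := 4 * H * K * Real.pi +
    ∫ t, (H * K * J t + (Icc (-R) R).indicator (fun _ => G) t) with hC
  have hC0 : 0 ≤ C := by
    refine add_nonneg (by positivity) (integral_nonneg fun t => ?_)
    exact add_nonneg (mul_nonneg (by positivity) (hJ0 t)) (indicator_nonneg (fun _ _ => hG0) t)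
  have hWC : ∀ y, ∫ t, W y t = C * |y| := fun y => by
    simp only [hW]
    rw [integral_add (hW1 y) (hW2 y), integral_const_mul (4 * H * K), integral_const_mul |y|,
      (integral_sq_mul_inv_one_add_sq y).2, hC]
    ring
  have hdom : ∀ (y : ℝ) (n : ℕ) (t : ℝ), t ≠ 0 → ∑ j ∈ Finset.range n,
      |h t * ((1 - Real.cos (t * y)) * c j t + Real.sin (t * y) * s j t)| ≤ W y t := by
    intro y n t ht
    have hW0 : 0 ≤ W y t := by
      refine add_nonneg (by positivity) (mul_nonneg (abs_nonneg _) ?_)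
      exact add_nonneg (mul_nonneg (by positivity) (hJ0 t)) (indicator_nonneg (fun _ _ => hG0) t)
    rcases lt_or_ge R |t| with hRt | hRt
    · simpa [hsupp t hRt] using hW0
    have hmem : t ∈ Icc (-R) R := abs_le.1 hRt
    have hcos0 : 0 ≤ 1 - Real.cos (t * y) := sub_nonneg.2 (Real.cos_le_one _)
    have hsin : |Real.sin (t * y)| ≤ |t| * |y| := by
      rw [← abs_mul]; exact Real.abs_sin_le_abs
    have b1 : ∑ j ∈ Finset.range n,
        |h t * ((1 - Real.cos (t * y)) * c j t + Real.sin (t * y) * s j t)| ≤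
        H * ((1 - Real.cos (t * y)) * ∑ j ∈ Finset.range n, |c j t| +
          |Real.sin (t * y)| * ∑ j ∈ Finset.range n, |s j t|) := by
      rw [Finset.mul_sum, Finset.mul_sum, ← Finset.sum_add_distrib, Finset.mul_sum]
      refine Finset.sum_le_sum fun j _ => ?_
      rw [abs_mul]
      refine mul_le_mul (hH t) ((abs_add_le _ _).trans_eq ?_) (abs_nonneg _) hH0
      rw [abs_mul, abs_mul, abs_of_nonneg hcos0]
    refine b1.trans ?_
    have e : W y t = H * (4 * K * (y ^ 2 * (1 + (t * y) ^ 2)⁻¹) + |y| * (K * J t) +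
        |y| * (K + R * K')) := by
      simp only [hW, indicator_of_mem hmem, hG]; ring
    rw [e]
    refine mul_le_mul_of_nonneg_left ?_ hH0
    rcases lt_or_ge |t| δ with hδ | hδ
    · obtain ⟨n1, n2⟩ := near t ht hδ n
      have htp : 0 < |t| := abs_pos.2 ht
      have hJt : |∫ x, Real.sin (t * φ x) ∂m| / |t| ^ 3 ≤ J t := by
        rw [div_le_iff₀' (by positivity)]
        exact abs_integral_sin_le hφ hφ1 hφ0 ht
      have a1 : (1 - Real.cos (t * y)) * ∑ j ∈ Finset.range n, |c j t| ≤
          4 * K * (y ^ 2 * (1 + (t * y) ^ 2)⁻¹) := by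
        calc (1 - Real.cos (t * y)) * ∑ j ∈ Finset.range n, |c j t|
            ≤ 4 * (t * y) ^ 2 * (1 + (t * y) ^ 2)⁻¹ * ∑ j ∈ Finset.range n, |c j t| := by
              gcongr
              exact Real.one_sub_cos_le_div _
          _ = 4 * (y ^ 2 * (1 + (t * y) ^ 2)⁻¹) * (t ^ 2 * ∑ j ∈ Finset.range n, |c j t|) := by
              ring
          _ ≤ 4 * (y ^ 2 * (1 + (t * y) ^ 2)⁻¹) * K := by gcongr
          _ = _ := by ring
      have a2 : |Real.sin (t * y)| * ∑ j ∈ Finset.range n, |s j t| ≤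
          |y| * (K * J t) + |y| * K := by
        calc |Real.sin (t * y)| * ∑ j ∈ Finset.range n, |s j t|
            ≤ (|t| * |y|) * ∑ j ∈ Finset.range n, |s j t| := by gcongr
          _ = |y| * (|t| * ∑ j ∈ Finset.range n, |s j t|) := by ring
          _ ≤ |y| * (K * (J t + 1)) := by
              refine mul_le_mul_of_nonneg_left (n2.trans ?_) (abs_nonneg _)
              gcongr
          _ = _ := by ring
      have a3 : 0 ≤ |y| * (R * K') := by positivity
      linarith
    · have a1 : (1 - Real.cos (t * y)) * ∑ j ∈ Finset.range n, |c j t| +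
          |Real.sin (t * y)| * ∑ j ∈ Finset.range n, |s j t| ≤ |y| * (R * K') := by
        calc (1 - Real.cos (t * y)) * ∑ j ∈ Finset.range n, |c j t| +
              |Real.sin (t * y)| * ∑ j ∈ Finset.range n, |s j t|
            ≤ (|t| * |y|) * ∑ j ∈ Finset.range n, |c j t| +
              (|t| * |y|) * ∑ j ∈ Finset.range n, |s j t| := by
              gcongr
              rw [← abs_mul]; exact Real.one_sub_cos_le_abs _
          _ = (|t| * |y|) * ∑ j ∈ Finset.range n, (|c j t| + |s j t|) := by
              rw [Finset.sum_add_distrib]; ring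
          _ ≤ (R * |y|) * K' := by
              gcongr
              exact (hK₀ t hδ hRt n).trans (le_max_left _ _)
          _ = _ := by ring
      have a2 : 0 ≤ 4 * K * (y ^ 2 * (1 + (t * y) ^ 2)⁻¹) := by positivity
      have a3 : 0 ≤ |y| * (K * J t) := mul_nonneg (abs_nonneg _) (mul_nonneg hK (hJ0 t))
      have a4 : 0 ≤ |y| * K := by positivity
      linarith
  have hint : ∀ (y : ℝ) (j : ℕ), Integrable fun t =>
      |h t * ((1 - Real.cos (t * y)) * c j t + Real.sin (t * y) * s j t)| := fun y j => by
    refine Integrable.abs (Continuous.integrable_of_hasCompactSupport ?_ hhs.mul_right)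
    have := hcc j
    have := hsc j
    fun_prop
  -- `C` may vanish, for instance when `h = 0`; the added `1` makes the constant positive.
  refine ⟨C + 1, by linarith, fun y n => ?_⟩
  calc ∑ j ∈ Finset.range n, |∫ t, h t * ((1 - Real.cos (t * y)) * c j t +
        Real.sin (t * y) * s j t)|
      ≤ ∑ j ∈ Finset.range n, ∫ t, |h t * ((1 - Real.cos (t * y)) * c j t +
        Real.sin (t * y) * s j t)| := Finset.sum_le_sum fun j _ => abs_integral_le_integral_abs
    _ = ∫ t, ∑ j ∈ Finset.range n, |h t * ((1 - Real.cos (t * y)) * c j t +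
        Real.sin (t * y) * s j t)| := (integral_finsetSum _ fun j _ => hint y j).symm
    _ ≤ ∫ t, W y t := by
        refine integral_mono_ae (integrable_finsetSum _ fun j _ => hint y j) (hWi y) ?_
        filter_upwards [compl_mem_ae_iff.2 (measure_singleton (0 : ℝ))] with t ht
        exact hdom y n t ht
    _ = C * |y| := hWC y
    _ ≤ (C + 1) * |y| := by gcongr; linarith

end Potential

end

/-! ### The potential kernel estimate -/

theorem mainTheorem2
    {X : Type*} [MeasurableSpace X] (m : Measure X) [IsProbabilityMeasure m]
    (T : X → X) (hT : MeasurePreserving T m m)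
    (φ : X → ℝ) (hφ : Measurable φ)
    {B : Type*} [NormedAddCommGroup B] [NormedSpace ℂ B] [CompleteSpace B]
    -- (A1): `B` is a Banach space of functions inside `L^∞(m)`
    (ι : B →ₗ[ℂ] Lp ℂ ∞ m) (hB : IsBanachFunctionSpace m ι)
    -- the operators `P(t)` act on `B` as bounded operators
    (P : ℝ → B →L[ℂ] B)
    (hP : ∀ (t : ℝ) (b : B), ι (P t b) =ᵐ[m] charOp m T φ t (ι b))
    -- (A2): quasi-compactness of `T̂ = P(0)`
    (hqc : IsQuasiCompactWith (P 0) (fun _ : Fin 1 => (1 : ℂ)))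
    (hN : ∃ N : B →L[ℂ] B, spectralRadius ℂ N < 1 ∧
      ∀ b, ∀ᵐ x ∂m, ι (P 0 b) x = (∫ z, ι b z ∂m) + ι (N b) x)
    -- (A3): mean zero and finite second moment
    (hφ2 : MemLp φ 2 m) (hφ0 : ∫ x, φ x ∂m = 0)
    -- (A4): continuity
    (hcont : Continuous P)
    -- (A5): differentiability near zero
    (hdiff : ∃ I₀ : Set ℝ, IsOpen I₀ ∧ (0 : ℝ) ∈ I₀ ∧ ContDiffOn ℝ 2 P I₀)
    (hderiv : ∀ b : B, ι (deriv P 0 b) =ᵐ[m]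
      transferOp m T fun x => Complex.I * φ x * ι b x)
    (hderiv2 : ∀ b : B, ι (iteratedDeriv 2 P 0 b) =ᵐ[m]
      transferOp m T fun x => -((φ x : ℂ) ^ 2) * ι b x)
    -- (A6): aperiodicity
    (haper : ∀ t : ℝ, t ≠ 0 → spectralRadius ℂ (P t) < 1)
    -- the test function
    (f : ℝ → ℝ) (hf_smooth : ContDiff ℝ (⊤ : ℕ∞) f) (hf_int : Integrable f volume)
    (hf_symm : ∀ x, f (-x) = f x)
    (hf_supp : HasCompactSupport (𝓕 (fun x : ℝ => (f x : ℂ)))) :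
    (∀ (n : ℕ) (y : ℝ), Integrable (fun x => f (birkhoffSum T φ n x + y)) m) ∧
    ∃ C : ℝ, 0 < C ∧ ∀ y : ℝ,
      Summable (fun n : ℕ =>
        |∫ x, (f (birkhoffSum T φ (n + 1) x) - f (birkhoffSum T φ (n + 1) x + y)) ∂m|) ∧
      ∑' n : ℕ,
        |∫ x, (f (birkhoffSum T φ (n + 1) x) - f (birkhoffSum T φ (n + 1) x + y)) ∂m| ≤
        C * |y| := by
  obtain ⟨ℓ, hℓ⟩ := hB.exists_integral
  obtain ⟨one, hone⟩ := hB.one_mem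
  obtain ⟨N, hNρ, hN⟩ := hN
  obtain ⟨I₀, hI₀, h0I, hPd⟩ := hdiff
  obtain ⟨h1, hP1, hPl⟩ := charOp_perturbation_eq hT hB hℓ hone hP
  have hρ : spectralRadius ℂ (P 0 - ℓ.smulRight one) < 1 := by
    rwa [sub_smulRight_eq hB hℓ hone hN]
  have hu : IsUnit (1 - (P 0 - ℓ.smulRight one)) := by
    have := spectrum.mem_resolventSet_of_spectralRadius_lt (𝕜 := ℂ)
      (a := P 0 - ℓ.smulRight one) (k := 1) (by simpa using hρ)
    rw [spectrum.mem_resolventSet_iff] at this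
    simpa using this
  have hφ1 : Integrable φ m := hφ2.integrable (by norm_num)
  have hP0 : ∀ b : B, ι (P 0 b) =ᵐ[m] transferOp m T (ι b) := fun b => by
    simpa [charOp_zero] using hP 0 b
  have hreal := second_order_coefficient_im_eq_zero hT hφ1 hB hℓ hone hP0 hu hderiv
  have hχ := apply_pow_one_eq_integral_exp_birkhoffSum hT hφ hℓ hone hP
  have hS := measurable_birkhoffSum hT.measurable hφ
  have hχ1 : ∀ t, ℓ (P t one) = ∫ x, Complex.exp (Complex.I * t * φ x) ∂m := fun t => by
    simpa using hχ t 1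
  have ha : (fun t : ℝ => ℓ (P t one) - (1 - (((∫ x, φ x ^ 2 ∂m) / 2 : ℝ) : ℂ) * t ^ 2))
      =o[𝓝 0] fun t : ℝ => t ^ 2 := by
    simp only [hχ1]
    exact integral_exp_isLittleO hφ2 hφ0
  obtain ⟨s, C, θ, hC, hθ0, hθ1, hexp⟩ := exists_spectral_expansion h1 hP1 hPl hρ
    (hPd.contDiffAt (hI₀.mem_nhds h0I)) hreal ha
  set χ : ℕ → ℝ → ℂ := fun n t => ℓ ((P t ^ n) one) with hχdef
  have hχre : ∀ n t, (χ n t).re = ∫ x, Real.cos (t * birkhoffSum T φ n x) ∂m := fun n t => by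
    rw [← integral_exp_re (hS n), ← hχ]
  have hχim : ∀ n t, (χ n t).im = ∫ x, Real.sin (t * birkhoffSum T φ n x) ∂m := fun n t => by
    rw [← integral_exp_im (hS n), ← hχ]
  have hχle : ∀ n t, ‖χ n t‖ ≤ ‖ℓ‖ * ‖one‖ * ‖P t ^ n‖ := fun n t =>
    calc ‖χ n t‖ ≤ ‖ℓ‖ * (‖P t ^ n‖ * ‖one‖) :=
          (ℓ.le_opNorm _).trans (by gcongr; exact (P t ^ n).le_opNorm _)
      _ = _ := by ring
  have hχ0 : ∀ t ≠ 0, Tendsto (fun n => χ n t) atTop (𝓝 0) := fun t ht => by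
    obtain ⟨C', θ', -, h0, h1, hev⟩ :=
      eventually_norm_pow_le_of_spectralRadius_lt_one (haper t ht)
    refine squeeze_zero_norm (a := fun n => ‖ℓ‖ * ‖one‖ * (C' * θ' ^ n)) (fun n => ?_) ?_
    · refine (hχle n t).trans ?_
      gcongr
      exact hev.self_of_nhds n
    · simpa using ((tendsto_pow_atTop_nhds_zero_of_lt_one h0.le h1).const_mul C').const_mul
        (‖ℓ‖ * ‖one‖)
  have hdouble : ∀ n t, 1 - (χ n (2 * t)).re ≤ 4 * (1 - (χ n t).re) := fun n t => by
    simp only [hχdef, hχ]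
    exact one_sub_re_integral_exp_two_mul_le (hS n) t
  -- Aperiodicity enters through `hχ0`: characteristic functions tending to `0` off the origin
  -- exclude a degenerate variance.
  have hs : 0 < s := by
    refine variance_pos_of_tendsto_zero hC hθ0 hθ1 hχ0 hdouble fun ε hε => ?_
    filter_upwards [hexp ε hε] with t ht
    obtain ⟨μ, c, e1, -, e3, e4⟩ := ht
    exact ⟨μ, c, e1, e3, e4⟩
  have hexp' : ∀ ε > 0, ∀ᶠ t : ℝ in 𝓝 0, ∃ μ c : ℂ, ‖μ - 1 + s * t ^ 2‖ ≤ ε * t ^ 2 ∧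
      |μ.im| ≤ |(χ 1 t).im| + C * |t| ^ 3 ∧
      ‖c - 1‖ ≤ C * t ^ 2 ∧ ∀ n : ℕ, ‖χ n t - c * μ ^ n‖ ≤ C * t ^ 2 * θ ^ n := by
    simpa only [hχdef, pow_one] using hexp
  obtain ⟨δ, K, hδ, hK, hnear⟩ := exists_sum_bounds_near_zero hs hC hθ0 hθ1 hexp'
  obtain ⟨h, hh, hhs, hfh⟩ := exists_cosine_representation hf_smooth.continuous hf_int hf_symm
    hf_supp
  have near : ∀ t : ℝ, t ≠ 0 → |t| < δ → ∀ n,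
      t ^ 2 * ∑ j ∈ Finset.range n, |∫ x, Real.cos (t * birkhoffSum T φ (j + 1) x) ∂m| ≤ K ∧
      |t| * ∑ j ∈ Finset.range n, |∫ x, Real.sin (t * birkhoffSum T φ (j + 1) x) ∂m| ≤
        K * (|∫ x, Real.sin (t * φ x) ∂m| / |t| ^ 3 + 1) := by
    intro t ht htδ n
    obtain ⟨n1, n2⟩ := hnear t ht htδ n
    simp only [hχim, birkhoffSum_one] at n2
    refine ⟨le_trans ?_ n1, n2⟩
    gcongr with j
    rw [← hχre]
    exact Complex.abs_re_le_norm _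
  have far : ∀ R : ℝ, ∃ K' : ℝ, ∀ t : ℝ, δ ≤ |t| → |t| ≤ R → ∀ n, ∑ j ∈ Finset.range n,
      (|∫ x, Real.cos (t * birkhoffSum T φ (j + 1) x) ∂m| +
        |∫ x, Real.sin (t * birkhoffSum T φ (j + 1) x) ∂m|) ≤ K' := by
    intro R
    have hcomp : IsCompact {t : ℝ | δ ≤ |t| ∧ |t| ≤ R} := by
      refine (isCompact_Icc (a := -R) (b := R)).of_isClosed_subset ?_ fun t ht => abs_le.1 ht.2
      exact (isClosed_le continuous_const continuous_abs).inter
        (isClosed_le continuous_abs continuous_const)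
    obtain ⟨K', hK'⟩ := hcomp.exists_sum_norm_pow_le hcont fun t ht =>
      haper t (abs_pos.1 (hδ.trans_le ht.1))
    refine ⟨2 * (‖ℓ‖ * ‖one‖) * K', fun t ht1 ht2 n => ?_⟩
    calc ∑ j ∈ Finset.range n, (|∫ x, Real.cos (t * birkhoffSum T φ (j + 1) x) ∂m| +
          |∫ x, Real.sin (t * birkhoffSum T φ (j + 1) x) ∂m|)
        ≤ ∑ j ∈ Finset.range n, 2 * (‖ℓ‖ * ‖one‖) * ‖P t ^ (j + 1)‖ := by
          refine Finset.sum_le_sum fun j _ => ?_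
          rw [← hχre, ← hχim]
          linarith [Complex.abs_re_le_norm (χ (j + 1) t), Complex.abs_im_le_norm (χ (j + 1) t),
            hχle (j + 1) t]
      _ ≤ _ := by
          rw [← Finset.mul_sum]
          gcongr
          exact hK' t ⟨ht1, ht2⟩ n
  refine ⟨fun n y => ?_, ?_⟩
  · obtain ⟨H, hH⟩ : ∃ H, ∀ x, ‖f x‖ ≤ H := by
      -- The cosine representation bounds `f` by the `L¹` norm of its density.
      refine ⟨∫ t, ‖h t‖, fun x => ?_⟩
      rw [hfh]
      refine norm_integral_le_of_norm_le (hh.integrable_of_hasCompactSupport hhs).norm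
        (Eventually.of_forall fun t => ?_)
      rw [norm_mul]
      exact mul_le_of_le_one_right (norm_nonneg _) (Real.abs_cos_le_one _)
    exact Integrable.of_bound (hf_smooth.continuous.measurable.comp
      ((hS n).add_const y)).aestronglyMeasurable H (Eventually.of_forall fun x => hH _)
  · obtain ⟨C', hC', hsum⟩ := exists_sum_abs_integral_le (fun j => hS (j + 1)) hφ hφ2 hφ0 hh hhs hK
      near far
    refine ⟨C', hC', fun y => ?_⟩
    have hbound : ∀ n, ∑ j ∈ Finset.range n,
        |∫ x, (f (birkhoffSum T φ (j + 1) x) - f (birkhoffSum T φ (j + 1) x + y)) ∂m| ≤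
        C' * |y| := fun n => by
      simp only [integral_sub_shift_eq hh hhs hfh (hS _)]
      exact hsum y n
    exact ⟨summable_of_sum_range_le (fun _ => abs_nonneg _) hbound,
      Real.tsum_le_of_sum_range_le (fun _ => abs_nonneg _) hbound⟩
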